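/- Let $d\ge 1$, and let $\|\cdot\|$ be the Euclidean norm on $\mathbb{R}^{d+1}$. A compact $C^2$-domain is a set $\Omega\subset\mathbb{R}^{d+1}$ that is the closure of a nonempty open, connected, bounded set and whose boundary $\Gamma=\partial\Omega$ is $C^2$ in the following sense: there are $\delta,M>0$ and a finite cover of $\Gamma$ by connected open sets $U_1,\dots,U_J$ such that (i) every $x\in\Omega$ with $\operatorname{dist}(x,\Gamma)<\delta$ lies in some $U_j$ with $\operatorname{dist}(x,\partial U_j)>\delta$; (ii) for each $j$ there is a Cartesian coordinate system $(x_1,\dots,x_{d+1})$ in which $\Omega\cap U_j$ is the set of points of $U_j$ with $x_{d+1}\le f_j(x_1,\dots,x_d)$, where $f_j:\mathbb{R}^d\to\mathbb{R}$ is a $C^2$ function with $\|\partial_i\partial_k f_j\|_\infty\le M$ for all $1\le i,k\le d$. For such $\Omega$ define the metric $$\rho_\Omega(\xi,\eta)=\|\xi-\eta\|+\Bigl|\sqrt{\operatorname{dist}(\xi,\Gamma)}-\sqrt{\operatorname{dist}(\eta,\Gamma)}\Bigr|,\qquad \xi,\eta\in\Omega .$$ **Theorem.** Let $d\ge1$ and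 $\ell>1$. There is a positive integer $c_0$, depending only on $d$ and $\ell$, such that for every compact $C^2$-domain $\Omega\subset\mathbb{R}^{d+1}$ there is a constant $C_1>0$, depending only on $\ell$ and $\Omega$, with the following property. For every positive integer $n$ there are finitely many points $\xi_1,\dots,\xi_{m_n}\in\Omega$ with $\rho_\Omega(\xi_i,\xi_j)\ge \frac1n$ for $i\ne j$, and real polynomials $P_1,\dots,P_{m_n}$ in $d+1$ variables, of total degree at most $c_0n$, such that for every $\xi\in\Omega$ $$\sum_{j=1}^{m_n}P_j(\xi)=1\qquad\text{and}\qquad |P_j(\xi)|\le C_1\bigl(1+n\rho_\Omega(\xi,\xi_j)\bigr)^{-\ell},\quad j=1,\dots,m_n .$$ -/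

import Mathlib

/-- `Ω` satisfies the local `C²` graph condition at its boundary `Γ = frontier Ω`: there are
`δ, M > 0` and a finite cover of `Γ` by connected open sets `U j` such that

* every `x ∈ Ω` with `dist(x, Γ) < δ` lies in some `U j` with `dist(x, ∂ (U j)) > δ`;
* for each `j` there is a Cartesian coordinate system (the coordinates of `T j x`, where `T j` is an
  affine isometry) in which `Ω ∩ U j` is given by `x_{d+1} ≤ f j (x₁, …, x_d)`, where
  `f j : ℝᵈ → ℝ` is a `C²` function all of whose second order partial derivatives are bounded
  by `M` in absolute value. -/
def HasC2Boundary {d : ℕ} (Ω : Set (EuclideanSpace ℝ (Fin (d + 1)))) : Prop :=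
  ∃ (δ M : ℝ) (J : ℕ) (U : Fin J → Set (EuclideanSpace ℝ (Fin (d + 1)))),
    0 < δ ∧ 0 < M ∧
    (∀ j, IsOpen (U j) ∧ IsConnected (U j)) ∧
    (frontier Ω ⊆ ⋃ j, U j) ∧
    (∀ x ∈ Ω, Metric.infDist x (frontier Ω) < δ →
      ∃ j, x ∈ U j ∧ δ < Metric.infDist x (frontier (U j))) ∧
    (∀ j, ∃ (T : EuclideanSpace ℝ (Fin (d + 1)) ≃ᵃⁱ[ℝ] EuclideanSpace ℝ (Fin (d + 1)))
        (f : EuclideanSpace ℝ (Fin d) → ℝ),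
      ContDiff ℝ 2 f ∧
      (∀ (i k : Fin d) (z : EuclideanSpace ℝ (Fin d)),
        |fderiv ℝ (fun w => fderiv ℝ f w (EuclideanSpace.single k 1)) z
          (EuclideanSpace.single i 1)| ≤ M) ∧
      (∀ x ∈ U j,
        (x ∈ Ω ↔ T x (Fin.last d) ≤ f (WithLp.toLp 2 fun i : Fin d => T x i.castSucc))))

/-- A compact `C²`-domain in `ℝ^{d+1}`: the closure of a (nonempty) open, connected and bounded
set, with `C²` boundary. -/
def IsCompactC2Domain {d : ℕ} (Ω : Set (EuclideanSpace ℝ (Fin (d + 1)))) : Prop :=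
  (∃ D : Set (EuclideanSpace ℝ (Fin (d + 1))),
    IsOpen D ∧ IsConnected D ∧ Bornology.IsBounded D ∧ Ω = closure D) ∧
  HasC2Boundary Ω

/-- The metric `ρ_Ω(ξ, η) = ‖ξ - η‖ + |√dist(ξ, Γ) - √dist(η, Γ)|`, where `Γ = frontier Ω`. -/
noncomputable def rhoMetric {d : ℕ} (Ω : Set (EuclideanSpace ℝ (Fin (d + 1))))
    (ξ η : EuclideanSpace ℝ (Fin (d + 1))) : ℝ :=
  ‖ξ - η‖ + |Real.sqrt (Metric.infDist ξ (frontier Ω)) -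
    Real.sqrt (Metric.infDist η (frontier Ω))|

theorem abs_sin_nat_mul_le (n : ℕ) (x : ℝ) : |Real.sin (n * x)| ≤ n * |Real.sin x| := by
  induction n with
  | zero => simp
  | succ n ih =>
    have h : ((n + 1 : ℕ) : ℝ) * x = n * x + x := by push_cast; ring
    rw [h, Real.sin_add]
    calc |Real.sin (n * x) * Real.cos x + Real.cos (n * x) * Real.sin x|
        ≤ |Real.sin (n * x)| * |Real.cos x| + |Real.cos (n * x)| * |Real.sin x| := by
          simpa only [abs_mul] using abs_add_le (Real.sin (n * x) * Real.cos x)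
            (Real.cos (n * x) * Real.sin x)
      _ ≤ |Real.sin (n * x)| * 1 + 1 * |Real.sin x| := by
          gcongr
          · exact Real.abs_cos_le_one x
          · exact Real.abs_cos_le_one _
      _ ≤ ((n + 1 : ℕ) : ℝ) * |Real.sin x| := by push_cast; linarith

/-- The Fejér kernel `sin² (n φ) / sin² φ` as a polynomial in `sin φ`. -/
theorem exists_fejer_polynomial (n : ℕ) : ∃ F : Polynomial ℝ, F.natDegree ≤ 2 * n ∧
    ∀ φ : ℝ, F.eval (Real.sin φ) * Real.sin φ ^ 2 = Real.sin (n * φ) ^ 2 := by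
  set g : Polynomial ℝ := 1 - (Polynomial.Chebyshev.T ℝ n).comp (1 - 2 * Polynomial.X) with hg
  have h0 : g.coeff 0 = 0 := by
    rw [Polynomial.coeff_zero_eq_eval_zero, hg]
    simp
  have hX : g.divX * Polynomial.X = g := by
    have := g.divX_mul_X_add
    rwa [h0, map_zero, add_zero] at this
  refine ⟨Polynomial.C (1 / 2) * g.divX.comp (Polynomial.X ^ 2), ?_, fun φ => ?_⟩
  · refine (Polynomial.natDegree_C_mul_le _ _).trans ?_
    rw [Polynomial.natDegree_comp, Polynomial.natDegree_X_pow,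
      Polynomial.natDegree_divX_eq_natDegree_tsub_one]
    have h1 : (1 - 2 * Polynomial.X : Polynomial ℝ).natDegree ≤ 1 := by compute_degree
    have h2 : g.natDegree ≤ n := by
      refine (Polynomial.natDegree_sub_le _ _).trans (max_le (by simp) ?_)
      rw [Polynomial.natDegree_comp, Polynomial.Chebyshev.natDegree_T]
      simpa using Nat.mul_le_mul_left n h1
    omega
  · have h3 : g.eval (Real.sin φ ^ 2) = 2 * Real.sin (n * φ) ^ 2 := by
      have h4 : 1 - 2 * Real.sin φ ^ 2 = Real.cos (2 * φ) := by
        rw [Real.cos_two_mul, Real.cos_sq']; ring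
      have h5 : (n : ℝ) * (2 * φ) = 2 * (n * φ) := by ring
      simp only [hg, Polynomial.eval_sub, Polynomial.eval_one, Polynomial.eval_comp,
        Polynomial.eval_mul, Polynomial.eval_ofNat, Polynomial.eval_X]
      rw [h4, Polynomial.Chebyshev.T_real_cos, Int.cast_natCast, h5, Real.cos_two_mul,
        Real.cos_sq']
      ring
    rw [← hX, Polynomial.eval_mul, Polynomial.eval_X] at h3
    simp only [Polynomial.eval_mul, Polynomial.eval_C, Polynomial.eval_comp, Polynomial.eval_pow,
      Polynomial.eval_X]
    linarith

theorem exists_needle_polynomial (n : ℕ) (hn : 0 < n) : ∃ F : Polynomial ℝ, F.natDegree ≤ 2 * n ∧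
    (∀ u ∈ Set.Icc (-1 : ℝ) 1, 0 ≤ F.eval u ∧ F.eval u * (1 + (n * u) ^ 2) ≤ 2 * n ^ 2) ∧
    ∀ u : ℝ, 0 < u → u < 1 / n → (n : ℝ) ^ 2 / 4 ≤ F.eval u := by
  obtain ⟨F, hdeg, hF⟩ := exists_fejer_polynomial n
  have hn' : (1 : ℝ) ≤ n := by exact_mod_cast hn
  have main : ∀ u ∈ Set.Icc (-1 : ℝ) 1, u ≠ 0 →
      0 ≤ F.eval u ∧ F.eval u * (1 + (n * u) ^ 2) ≤ 2 * n ^ 2 := by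
    intro u hu hu0
    have hs : Real.sin (Real.arcsin u) = u := Real.sin_arcsin hu.1 hu.2
    have h1 := hF (Real.arcsin u)
    have h2 := abs_sin_nat_mul_le n (Real.arcsin u)
    have h3 := Real.sin_sq_le_one (n * Real.arcsin u)
    rw [hs] at h1 h2
    have hu2 : 0 < u ^ 2 := by positivity
    have h4 : Real.sin (n * Real.arcsin u) ^ 2 ≤ n ^ 2 * u ^ 2 := by
      rw [← sq_abs, ← sq_abs u, ← mul_pow]
      exact pow_le_pow_left₀ (abs_nonneg _) h2 2
    have h5 : F.eval u ≤ n ^ 2 := by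
      rw [← h1] at h4
      exact le_of_mul_le_mul_right h4 hu2
    refine ⟨?_, ?_⟩
    · by_contra! h
      nlinarith [sq_nonneg (Real.sin (n * Real.arcsin u))]
    · have : F.eval u * (1 + (n * u) ^ 2) = F.eval u + n ^ 2 * (F.eval u * u ^ 2) := by ring
      rw [this, h1]
      nlinarith [sq_nonneg (n : ℝ)]
  refine ⟨F, hdeg, fun u hu => ?_, fun u hu0 hu1 => ?_⟩
  · by_cases hu0 : u = 0
    · subst hu0
      have hev : ∀ᶠ v in nhdsWithin (0 : ℝ) {0}ᶜ, v ∈ Set.Icc (-1 : ℝ) 1 ∧ v ≠ 0 :=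
        Filter.Eventually.and
          (mem_nhdsWithin_of_mem_nhds (Icc_mem_nhds (by norm_num) (by norm_num)))
          self_mem_nhdsWithin
      have hc : ∀ f : ℝ → ℝ, Continuous f → Filter.Tendsto f (nhdsWithin 0 {0}ᶜ) (nhds (f 0)) :=
        fun f hf => hf.continuousAt.tendsto.mono_left nhdsWithin_le_nhds
      constructor
      · exact ge_of_tendsto (hc (fun u => F.eval u) F.continuous)
          (hev.mono fun v hv => (main v hv.1 hv.2).1)
      · exact le_of_tendsto (hc (fun u => F.eval u * (1 + (n * u) ^ 2)) (by fun_prop))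
          (hev.mono fun v hv => (main v hv.1 hv.2).2)
    · exact main u hu hu0
  · have hu1' : u ≤ 1 := hu1.le.trans (by rw [div_le_one (by positivity)]; exact hn')
    have hs : Real.sin (Real.arcsin u) = u := Real.sin_arcsin (by linarith) hu1'
    have h1 := hF (Real.arcsin u)
    rw [hs] at h1
    have hpos : 0 ≤ Real.arcsin u := Real.arcsin_nonneg.2 hu0.le
    have hle := Real.mul_le_sin hpos (Real.arcsin_le_pi_div_two u)
    rw [hs] at hle
    have hpi := Real.pi_pos
    have hself : u ≤ Real.arcsin u := by
      have := Real.sin_le hpos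
      rwa [hs] at this
    have hle2 : n * Real.arcsin u ≤ Real.pi / 2 := by
      rw [div_mul_eq_mul_div, div_le_iff₀ hpi] at hle
      rw [lt_div_iff₀ (by positivity)] at hu1
      nlinarith
    have h3 := Real.mul_le_sin (by positivity) hle2
    have h4 : (n : ℝ) * u / 2 ≤ Real.sin (n * Real.arcsin u) := by
      refine le_trans ?_ h3
      have : (1 : ℝ) / 2 ≤ 2 / Real.pi := by
        rw [div_le_div_iff₀ (by norm_num) hpi]; linarith [Real.pi_le_four]
      calc (n : ℝ) * u / 2 = 1 / 2 * (n * u) := by ring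
        _ ≤ 2 / Real.pi * (n * Real.arcsin u) := by gcongr
    have h5 := pow_le_pow_left₀ (by positivity) h4 2
    rw [← h1] at h5
    have : (n : ℝ) ^ 2 / 4 * u ^ 2 ≤ F.eval u * u ^ 2 := by linarith [h5, show ((n : ℝ) * u / 2) ^ 2 = n ^ 2 / 4 * u ^ 2 by ring]
    exact le_of_mul_le_mul_right this (by positivity)

theorem Polynomial.exists_derivative_eq (p : Polynomial ℝ) :
    ∃ q : Polynomial ℝ, Polynomial.derivative q = p ∧ q.natDegree ≤ p.natDegree + 1 := by
  have key : ∃ q : Polynomial ℝ, Polynomial.derivative q = p := by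
    induction p using Polynomial.induction_on' with
    | add p q hp hq =>
      obtain ⟨a, ha⟩ := hp
      obtain ⟨b, hb⟩ := hq
      exact ⟨a + b, by rw [Polynomial.derivative_add, ha, hb]⟩
    | monomial n a =>
      refine ⟨Polynomial.monomial (n + 1) (a / (n + 1)), ?_⟩
      rw [Polynomial.derivative_monomial]
      have : (n : ℝ) + 1 ≠ 0 := by positivity
      congr 1
      push_cast
      field_simp
  obtain ⟨q, hq⟩ := key
  refine ⟨q, hq, ?_⟩
  rw [← hq, Polynomial.natDegree_derivative]
  omega

/-- A polynomial kernel concentrated at scale `1 / n`. -/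
theorem exists_localized_kernel (m : ℕ) : ∃ (A : ℕ) (C : ℝ), 0 < C ∧ ∀ n : ℕ, 0 < n →
    ∃ K : Polynomial ℝ, K.natDegree ≤ A * n ∧ (∀ u ∈ Set.Icc (-1 : ℝ) 1, 0 ≤ K.eval u) ∧
      (∫ u in (-1 : ℝ)..1, K.eval u) = 1 ∧
      (∫ u in (-1 : ℝ)..1, K.eval u * (2 + n * |u|) ^ m) ≤ C := by
  refine ⟨2 * (m + 1), 8 ^ (m + 1) * 3 ^ m * Real.pi, by positivity, fun n hn => ?_⟩
  obtain ⟨F, hdeg, hF, hlow⟩ := exists_needle_polynomial n hn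
  have hn' : (1 : ℝ) ≤ n := by exact_mod_cast hn
  have hn0 : (0 : ℝ) < n := by linarith
  set I := ∫ u in (-1 : ℝ)..1, (F ^ (m + 1)).eval u with hI
  have hcont : Continuous fun u => (F ^ (m + 1)).eval u := (F ^ (m + 1)).continuous
  have hnn : ∀ u ∈ Set.Icc (-1 : ℝ) 1, 0 ≤ (F ^ (m + 1)).eval u := fun u hu => by
    rw [Polynomial.eval_pow]; exact pow_nonneg (hF u hu).1 _
  have h1n : (1 : ℝ) / n ≤ 1 := by rw [div_le_one hn0]; exact hn'
  have h1n0 : (0 : ℝ) < 1 / n := by positivity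
  have hIlow : ((n : ℝ) ^ 2 / 4) ^ (m + 1) * (1 / n) ≤ I := by
    have e1 : ∫ _ in (0 : ℝ)..(1 / n), ((n : ℝ) ^ 2 / 4) ^ (m + 1) =
        ((n : ℝ) ^ 2 / 4) ^ (m + 1) * (1 / n) := by
      rw [intervalIntegral.integral_const, smul_eq_mul]; ring
    rw [← e1]
    calc ∫ _ in (0 : ℝ)..(1 / n), ((n : ℝ) ^ 2 / 4) ^ (m + 1)
        ≤ ∫ u in (0 : ℝ)..(1 / n), (F ^ (m + 1)).eval u := by
          refine intervalIntegral.integral_mono_on_of_le_Ioo h1n0.le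
            (continuous_const.intervalIntegrable _ _) (hcont.intervalIntegrable _ _) ?_
          intro u hu
          rw [Polynomial.eval_pow]
          exact pow_le_pow_left₀ (by positivity) (hlow u hu.1 hu.2) _
      _ ≤ I := by
          refine intervalIntegral.integral_mono_interval (by norm_num) h1n0.le h1n ?_
            (hcont.intervalIntegrable _ _)
          refine (MeasureTheory.ae_restrict_iff' measurableSet_Ioc).2 (Filter.Eventually.of_forall ?_)
          exact fun u hu => hnn u (Set.Ioc_subset_Icc_self hu)
  have hIpos : 0 < I := lt_of_lt_of_le (by positivity) hIlow
  refine ⟨Polynomial.C I⁻¹ * F ^ (m + 1), ?_, fun u hu => ?_, ?_, ?_⟩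
  · refine (Polynomial.natDegree_C_mul_le _ _).trans (Polynomial.natDegree_pow_le.trans ?_)
    calc (m + 1) * F.natDegree ≤ (m + 1) * (2 * n) := Nat.mul_le_mul_left _ hdeg
      _ = _ := by ring
  · rw [Polynomial.eval_mul, Polynomial.eval_C]
    exact mul_nonneg (inv_nonneg.2 hIpos.le) (hnn u hu)
  · simp only [Polynomial.eval_mul, Polynomial.eval_C]
    rw [intervalIntegral.integral_const_mul]
    exact inv_mul_cancel₀ hIpos.ne'
  · have hpt : ∀ u ∈ Set.Icc (-1 : ℝ) 1, (F ^ (m + 1)).eval u * (2 + n * |u|) ^ m ≤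
        (2 * n ^ 2) ^ (m + 1) * 3 ^ m * (1 + (n * u) ^ 2)⁻¹ := by
      intro u hu
      obtain ⟨h0, h1⟩ := hF u hu
      have hw : 0 < 1 + (n * u) ^ 2 := by positivity
      have h2 : 2 + n * |u| ≤ 3 * (1 + (n * u) ^ 2) := by
        have : (n * u) ^ 2 = (n * |u|) ^ 2 := by rw [mul_pow, mul_pow, sq_abs]
        rw [this]
        nlinarith [sq_nonneg (n * |u| - 1), mul_nonneg hn0.le (abs_nonneg u)]
      rw [Polynomial.eval_pow, ← div_eq_mul_inv, le_div_iff₀ hw]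
      calc F.eval u ^ (m + 1) * (2 + n * |u|) ^ m * (1 + (n * u) ^ 2)
          ≤ F.eval u ^ (m + 1) * (3 * (1 + (n * u) ^ 2)) ^ m * (1 + (n * u) ^ 2) := by gcongr
        _ = (F.eval u * (1 + (n * u) ^ 2)) ^ (m + 1) * 3 ^ m := by
            rw [mul_pow 3, mul_pow (F.eval u), pow_succ (1 + (n * u) ^ 2)]; ring
        _ ≤ (2 * n ^ 2) ^ (m + 1) * 3 ^ m := by gcongr
    have hint : ∫ u in (-1 : ℝ)..1, (1 + (n * u) ^ 2)⁻¹ ≤ Real.pi / n := by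
      have := intervalIntegral.integral_comp_mul_left (a := -1) (b := 1)
        (fun x : ℝ => (1 + x ^ 2)⁻¹) hn0.ne'
      rw [this, integral_inv_one_add_sq, smul_eq_mul]
      rw [inv_mul_eq_div]
      gcongr
      have h1 := (Real.arctan_lt_pi_div_two (n * 1)).le
      have h2 := (Real.neg_pi_div_two_lt_arctan (n * -1)).le
      linarith
    have hc2 : Continuous fun u : ℝ => (1 + ((n : ℝ) * u) ^ 2)⁻¹ :=
      Continuous.inv₀ (by fun_prop) fun u => by positivity
    have hbig : ∫ u in (-1 : ℝ)..1, (F ^ (m + 1)).eval u * (2 + n * |u|) ^ m ≤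
        (2 * n ^ 2) ^ (m + 1) * 3 ^ m * (Real.pi / n) := by
      calc _ ≤ ∫ u in (-1 : ℝ)..1, (2 * (n : ℝ) ^ 2) ^ (m + 1) * 3 ^ m * (1 + (n * u) ^ 2)⁻¹ := by
            refine intervalIntegral.integral_mono_on (by norm_num) ?_ ?_ hpt
            · exact Continuous.intervalIntegrable (by fun_prop) _ _
            · exact (hc2.const_mul _).intervalIntegrable _ _
        _ ≤ _ := by
            rw [intervalIntegral.integral_const_mul]
            gcongr
    have e2 : ∀ u : ℝ, (Polynomial.C I⁻¹ * F ^ (m + 1)).eval u * (2 + n * |u|) ^ m =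
        I⁻¹ * ((F ^ (m + 1)).eval u * (2 + n * |u|) ^ m) := fun u => by
      rw [Polynomial.eval_mul, Polynomial.eval_C]; ring
    simp only [e2]
    rw [intervalIntegral.integral_const_mul, inv_mul_le_iff₀ hIpos]
    refine hbig.trans ?_
    calc (2 * (n : ℝ) ^ 2) ^ (m + 1) * 3 ^ m * (Real.pi / n)
        = ((n : ℝ) ^ 2 / 4) ^ (m + 1) * (1 / n) * (8 ^ (m + 1) * 3 ^ m * Real.pi) := by
          have : (2 * (n : ℝ) ^ 2) = (n : ℝ) ^ 2 / 4 * 8 := by ring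
          rw [this, mul_pow]; ring
      _ ≤ _ := by gcongr

/-- A polynomial partition of unity on `[-1/2, 1/2]`, localized at scale `1 / n`. -/
theorem exists_polynomial_partition (m : ℕ) : ∃ (A : ℕ) (C : ℝ), 0 < C ∧ ∀ n : ℕ, 0 < n →
    ∃ (p : Fin n → Polynomial ℝ) (c : Fin n → ℝ), (∀ k, (p k).natDegree ≤ A * n) ∧
      (∀ s, ∑ k, (p k).eval s = 1) ∧
      ∀ s ∈ Set.Icc (-1 / 2 : ℝ) (1 / 2),
        ∑ k, |(p k).eval s| * (1 + n * |s - c k|) ^ m ≤ C := by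
  obtain ⟨A, C, hC, h⟩ := exists_localized_kernel m
  refine ⟨A + 1, C, hC, fun n hn => ?_⟩
  obtain ⟨K, hdeg, hK0, hK1, hKm⟩ := h n hn
  obtain ⟨G, hG, hGdeg⟩ := K.exists_derivative_eq
  have hn0 : (0 : ℝ) < n := by exact_mod_cast hn
  have hftc : ∀ a b : ℝ, ∫ u in a..b, K.eval u = G.eval b - G.eval a := fun a b => by
    refine intervalIntegral.integral_eq_sub_of_hasDerivAt (f := fun v => G.eval v) (fun x _ => ?_)
      (K.continuous.intervalIntegrable _ _)
    rw [← hG]; exact G.hasDerivAt x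
  set e : ℕ → Polynomial ℝ := fun k => if k = 0 then Polynomial.C (G.eval 1) else
    if k < n then G.comp (Polynomial.X - Polynomial.C (-1 / 2 + (k : ℝ) / n))
    else Polynomial.C (G.eval (-1)) with he
  set u : ℝ → ℕ → ℝ := fun s k => if k = 0 then 1 else
    if k < n then s - (-1 / 2 + (k : ℝ) / n) else -1 with hu
  have heu : ∀ s k, (e k).eval s = G.eval (u s k) := fun s k => by
    simp only [he, hu]; split_ifs <;> simp
  have hedeg : ∀ k, (e k).natDegree ≤ (A + 1) * n := fun k => by
    have : G.natDegree ≤ (A + 1) * n := by nlinarith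
    simp only [he]
    split_ifs
    · simp
    · rw [Polynomial.natDegree_comp, Polynomial.natDegree_X_sub_C, mul_one]; exact this
    · simp
  have hu0 : ∀ s, u s 0 = 1 := fun s => by simp [hu]
  have hun : ∀ s, u s n = -1 := fun s => by simp [hu, hn.ne']
  refine ⟨fun k => e k - e (k + 1), fun k => -1 / 2 + (k : ℝ) / n, fun k => ?_, fun s => ?_,
    fun s hs => ?_⟩
  · exact (Polynomial.natDegree_sub_le _ _).trans (max_le (hedeg _) (hedeg _))
  · rw [Fin.sum_univ_eq_sum_range (fun k => (e k - e (k + 1)).eval s)]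
    simp only [Polynomial.eval_sub, heu]
    rw [Finset.sum_range_sub' (fun k => G.eval (u s k)), hu0, hun, ← hftc, hK1]
  · have hfrac : ∀ k : ℕ, k < n → (k : ℝ) / n + 1 / n ≤ 1 := fun k hk => by
      rw [← add_div, div_le_one hn0]; exact_mod_cast hk
    have hfrac0 : ∀ k : ℕ, 0 ≤ (k : ℝ) / n := fun k => by positivity
    have hsucc : ∀ k : ℕ, ((k + 1 : ℕ) : ℝ) / n = (k : ℝ) / n + 1 / n := fun k => by
      push_cast; rw [add_div]
    have h1n : (0 : ℝ) < 1 / n := by positivity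
    have hmem : ∀ k, u s k ∈ Set.Icc (-1 : ℝ) 1 := fun k => by
      simp only [hu]
      split_ifs with h1 h2
      · norm_num
      · have := hfrac k h2
        have := hfrac0 k
        constructor <;> linarith [hs.1, hs.2]
      · norm_num
    have hanti : ∀ k < n, u s (k + 1) ≤ u s k := fun k hk => by
      by_cases h0 : k = 0
      · subst h0; rw [hu0]; exact (hmem _).2
      · by_cases h1 : k + 1 < n
        · simp only [hu, h0, hk, h1, if_true, if_false, Nat.add_eq_zero_iff, one_ne_zero, and_false]
          rw [hsucc]; linarith
        · have : u s (k + 1) = -1 := by simp [hu, h1]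
          rw [this]; exact (hmem _).1
    have hdist : ∀ k < n, ∀ v ∈ Set.Icc (u s (k + 1)) (u s k),
        |s - (-1 / 2 + (k : ℝ) / n)| ≤ |v| + 1 / n := fun k hk v hv => by
      have hup : v ≤ s - (-1 / 2 + (k : ℝ) / n) ∨ k = 0 := by
        by_cases h0 : k = 0
        · exact Or.inr h0
        · left
          have := hv.2
          simpa only [hu, h0, hk, if_true, if_false] using this
      have hlow : s - (-1 / 2 + (k : ℝ) / n) - 1 / n ≤ v ∨ (k : ℝ) / n + 1 / n = 1 := by
        by_cases h1 : k + 1 < n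
        · left
          have := hv.1
          simp only [hu, h1, if_true, if_false, Nat.add_eq_zero_iff, one_ne_zero, and_false,
            hsucc] at this
          linarith
        · right
          have : k + 1 = n := by omega
          rw [← hsucc, this, div_self hn0.ne']
      have a1 := le_abs_self v
      have a2 := neg_abs_le v
      have hs1 := hs.1
      have hs2 := hs.2
      rw [abs_le]
      constructor
      · rcases hup with hup | hup
        · linarith
        · subst hup; simp only [CharP.cast_eq_zero, zero_div, add_zero]; linarith [abs_nonneg v]
      · rcases hlow with hlow | hlow
        · linarith
        · linarith [abs_nonneg v]
    have hcont : Continuous fun v : ℝ => K.eval v * (2 + n * |v|) ^ m := by fun_prop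
    have hterm : ∀ k < n, |(e k - e (k + 1)).eval s| * (1 + n * |s - (-1 / 2 + (k : ℝ) / n)|) ^ m ≤
        -∫ v in (u s k)..(u s (k + 1)), K.eval v * (2 + n * |v|) ^ m := fun k hk => by
      have hsub : Set.Icc (u s (k + 1)) (u s k) ⊆ Set.Icc (-1 : ℝ) 1 :=
        Set.Icc_subset_Icc (hmem _).1 (hmem _).2
      rw [Polynomial.eval_sub, heu, heu, ← hftc, abs_of_nonneg
        (intervalIntegral.integral_nonneg (hanti k hk) fun v hv => hK0 v (hsub hv)),
        ← intervalIntegral.integral_symm, ← intervalIntegral.integral_mul_const]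
      refine intervalIntegral.integral_mono_on (hanti k hk)
        ((K.continuous.mul_const _).intervalIntegrable _ _) (hcont.intervalIntegrable _ _) ?_
      intro v hv
      refine mul_le_mul_of_nonneg_left (pow_le_pow_left₀ (by positivity) ?_ m) (hK0 v (hsub hv))
      have := mul_le_mul_of_nonneg_left (hdist k hk v hv) hn0.le
      rw [mul_add, mul_one_div_cancel hn0.ne'] at this
      linarith
    rw [Fin.sum_univ_eq_sum_range
      (fun k => |(e k - e (k + 1)).eval s| * (1 + n * |s - (-1 / 2 + (k : ℝ) / n)|) ^ m)]
    refine (Finset.sum_le_sum fun k hk => hterm k (Finset.mem_range.1 hk)).trans ?_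
    rw [Finset.sum_neg_distrib, intervalIntegral.sum_integral_adjacent_intervals
      fun k _ => hcont.intervalIntegrable _ _, hu0, hun, ← intervalIntegral.integral_symm]
    exact hKm

theorem Polynomial.exists_eval_sq_eq_even_part (p : Polynomial ℝ) :
    ∃ q : Polynomial ℝ, q.natDegree ≤ p.natDegree ∧
      ∀ s : ℝ, q.eval (s ^ 2) = (p.eval s + p.eval (-s)) / 2 := by
  refine ⟨∑ j ∈ Finset.range (p.natDegree + 1),
    if Even j then Polynomial.C (p.coeff j) * Polynomial.X ^ (j / 2) else 0, ?_, fun s => ?_⟩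
  · refine Polynomial.natDegree_sum_le_of_forall_le _ _ fun j hj => ?_
    have := Finset.mem_range.1 hj
    split_ifs
    · refine (Polynomial.natDegree_C_mul_X_pow_le _ _).trans ?_
      omega
    · simp
  · rw [Polynomial.eval_finsetSum, Polynomial.eval_eq_sum_range, Polynomial.eval_eq_sum_range,
      ← Finset.sum_add_distrib, Finset.sum_div]
    refine Finset.sum_congr rfl fun j _ => ?_
    rcases Nat.even_or_odd j with hj | hj
    · obtain ⟨i, rfl⟩ := hj
      have h2 : (i + i) / 2 = i := by omega
      rw [if_pos ⟨i, rfl⟩]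
      simp only [Polynomial.eval_mul, Polynomial.eval_C, Polynomial.eval_pow, Polynomial.eval_X, h2]
      rw [← two_mul, pow_mul, pow_mul, neg_sq]; ring
    · rw [if_neg (Nat.not_even_iff_odd.2 hj), hj.neg_pow]
      simp

/-- A polynomial partition of unity on `[0, 1/4]`, localized at scale `1 / n` in the metric
`|√t - √t'|`. -/
theorem exists_polynomial_partition_sqrt (m : ℕ) : ∃ (A : ℕ) (C : ℝ), 0 < C ∧ ∀ n : ℕ, 0 < n →
    ∃ (q : Fin n → Polynomial ℝ) (c : Fin n → ℝ), (∀ k, (q k).natDegree ≤ A * n) ∧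
      (∀ t, 0 ≤ t → ∑ k, (q k).eval t = 1) ∧
      ∀ t ∈ Set.Icc (0 : ℝ) (1 / 4),
        ∑ k, |(q k).eval t| * (1 + n * |√t - c k|) ^ m ≤ C := by
  obtain ⟨A, C, hC, h⟩ := exists_polynomial_partition m
  refine ⟨A, C, hC, fun n hn => ?_⟩
  obtain ⟨p, c, hdeg, hsum, hp⟩ := h n hn
  choose q hqdeg hq using fun k => (p k).exists_eval_sq_eq_even_part
  refine ⟨q, fun k => |c k|, fun k => (hqdeg k).trans (hdeg k), fun t ht => ?_, fun t ht => ?_⟩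
  · rw [← Real.sq_sqrt ht]
    simp only [hq]
    rw [← Finset.sum_div, Finset.sum_add_distrib, hsum, hsum]
    norm_num
  · have hle : √t ≤ 1 / 2 := by
      rw [Real.sqrt_le_left (by norm_num)]; norm_num; linarith [ht.2]
    have h0 := Real.sqrt_nonneg t
    have h1 := hp (√t) ⟨by linarith, hle⟩
    have h2 := hp (-√t) ⟨by linarith, by linarith⟩
    have hterm : ∀ k, |(q k).eval t| * (1 + n * |√t - (|c k|)|) ^ m ≤
        (|(p k).eval (√t)| * (1 + n * |√t - c k|) ^ m +
          |(p k).eval (-√t)| * (1 + n * |-√t - c k|) ^ m) / 2 := fun k => by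
      have e1 : |√t - (|c k|)| ≤ |√t - c k| := by
        have := abs_abs_sub_abs_le (√t) (c k)
        rwa [abs_of_nonneg h0] at this
      have e2 : |√t - (|c k|)| ≤ |-√t - c k| := by
        have := abs_abs_sub_abs_le (-√t) (c k)
        rwa [abs_neg, abs_of_nonneg h0] at this
      have e3 : |(q k).eval t| ≤ (|(p k).eval (√t)| + |(p k).eval (-√t)|) / 2 := by
        rw [← Real.sq_sqrt ht.1, hq, abs_div, abs_two, Real.sq_sqrt ht.1]
        gcongr
        exact abs_add_le _ _
      calc _ ≤ (|(p k).eval (√t)| + |(p k).eval (-√t)|) / 2 * (1 + n * |√t - (|c k|)|) ^ m := by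
            gcongr
        _ = (|(p k).eval (√t)| * (1 + n * |√t - (|c k|)|) ^ m +
          |(p k).eval (-√t)| * (1 + n * |√t - (|c k|)|) ^ m) / 2 := by ring
        _ ≤ _ := by gcongr
    refine (Finset.sum_le_sum fun k _ => hterm k).trans ?_
    rw [← Finset.sum_div, Finset.sum_add_distrib]
    linarith

/-- The uniform two-sided ball condition with radius `r` for a set `Ω`: every boundary point `p`
has a unit normal `ν` such that the open ball of radius `r` about `p + r ν` misses `Ω` and the open
ball of radius `r` about `p - r ν` lies in `Ω`. -/
def HasTwoSidedBalls {E : Type*} [NormedAddCommGroup E] [InnerProductSpace ℝ E]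
    (Ω : Set E) (r : ℝ) : Prop :=
  ∀ p ∈ frontier Ω, ∃ ν : E, ‖ν‖ = 1 ∧
    (∀ x, ‖x - p‖ ^ 2 < 2 * r * inner ℝ ν (x - p) → x ∉ Ω) ∧
    ∀ x, ‖x - p‖ ^ 2 < -(2 * r * inner ℝ ν (x - p)) → x ∈ Ω

theorem EuclideanSpace.opNorm_le_of_single {d : ℕ} (φ : EuclideanSpace ℝ (Fin d) →L[ℝ] ℝ) {B : ℝ}
    (hB : 0 ≤ B) (h : ∀ i, |φ (EuclideanSpace.single i 1)| ≤ B) : ‖φ‖ ≤ d * B := by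
  refine φ.opNorm_le_bound (by positivity) fun v => ?_
  have hv : φ v = ∑ i, v i * φ (EuclideanSpace.single i 1) := by
    conv_lhs => rw [← (EuclideanSpace.basisFun (Fin d) ℝ).sum_repr v]
    simp
  rw [hv]
  calc ‖∑ i, v i * φ (EuclideanSpace.single i 1)‖
      ≤ ∑ i, ‖v i * φ (EuclideanSpace.single i 1)‖ := norm_sum_le _ _
    _ ≤ ∑ _i : Fin d, ‖v‖ * B := by
        refine Finset.sum_le_sum fun i _ => ?_
        rw [norm_mul]
        exact mul_le_mul (PiLp.norm_apply_le v i) (h i) (norm_nonneg _) (norm_nonneg _)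
    _ = d * B * ‖v‖ := by simp; ring

theorem abs_taylor_remainder_le {d : ℕ} {f : EuclideanSpace ℝ (Fin d) → ℝ} {M : ℝ} (hM : 0 ≤ M)
    (hf : ContDiff ℝ 2 f)
    (hb : ∀ (i k : Fin d) (z : EuclideanSpace ℝ (Fin d)),
        |fderiv ℝ (fun w => fderiv ℝ f w (EuclideanSpace.single k 1)) z
          (EuclideanSpace.single i 1)| ≤ M) (w z : EuclideanSpace ℝ (Fin d)) :
    |f z - f w - fderiv ℝ f w (z - w)| ≤ d * (d * M) * ‖z - w‖ ^ 2 := by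
  have hdf : ContDiff ℝ 1 (fderiv ℝ f) := hf.fderiv_right (by norm_num)
  have hlip : ∀ y, ‖fderiv ℝ f y - fderiv ℝ f w‖ ≤ d * (d * M * ‖y - w‖) := fun y => by
    refine EuclideanSpace.opNorm_le_of_single _ (by positivity) fun k => ?_
    have hg : Differentiable ℝ fun v => fderiv ℝ f v (EuclideanSpace.single k 1) :=
      (hdf.differentiable (by norm_num)).clm_apply (differentiable_const _)
    exact convex_univ.norm_image_sub_le_of_norm_fderiv_le (fun v _ => hg v)
      (fun v _ => EuclideanSpace.opNorm_le_of_single _ hM fun i => hb i k v)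
      (Set.mem_univ w) (Set.mem_univ y)
  have := (convex_closedBall w ‖z - w‖).norm_image_sub_le_of_norm_fderiv_le' (𝕜 := ℝ)
    (f := f) (φ := fderiv ℝ f w) (C := d * (d * M * ‖z - w‖)) (x := w) (y := z)
    (fun v _ => hf.differentiable (by norm_num) v) (fun v hv => (hlip v).trans ?_)
    (Metric.mem_closedBall_self (norm_nonneg _)) (by rw [Metric.mem_closedBall, dist_eq_norm])
  · rw [Real.norm_eq_abs] at this
    linarith
  · rw [Metric.mem_closedBall, dist_eq_norm] at hv
    gcongr

theorem ball_subset_of_lt_infDist_frontier {E : Type*} [NormedAddCommGroup E] [NormedSpace ℝ E]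
    [FiniteDimensional ℝ E] {U : Set E} {p : E} {δ : ℝ} (hp : p ∈ U)
    (hδ : δ ≤ Metric.infDist p (frontier U)) : Metric.ball p δ ⊆ U := by
  intro x hx
  by_contra hxU
  obtain ⟨y, hy, hyd⟩ := exists_mem_frontier_infDist_compl_eq_dist hp
    (fun h => hxU (h ▸ Set.mem_univ x))
  have h1 : Metric.infDist p Uᶜ ≤ dist p x := Metric.infDist_le_dist_of_mem hxU
  have h2 := Metric.infDist_le_dist_of_mem hy (x := p)
  rw [Metric.mem_ball, dist_comm] at hx
  linarith

theorem HasC2Boundary.exists_hasTwoSidedBalls {d : ℕ} {Ω : Set (EuclideanSpace ℝ (Fin (d + 1)))}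
    (hcl : IsClosed Ω) (h : HasC2Boundary Ω) : ∃ r > 0, HasTwoSidedBalls Ω r := by
  obtain ⟨δ, M, J, U, hδ, hM, hU, -, hloc, hgraph⟩ := h
  set K : ℝ := d * (d * M) with hK
  have hK0 : 0 ≤ K := by positivity
  refine ⟨min (δ / 2) (1 / (2 * (K + 1))), by positivity, fun p hp => ?_⟩
  set r := min (δ / 2) (1 / (2 * (K + 1))) with hr
  have hr0 : 0 < r := by positivity
  have hrδ : 2 * r ≤ δ := by have : r ≤ δ / 2 := min_le_left _ _
                             linarith
  have hrK : 2 * r * (K + 1) ≤ 1 := by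
    have : r ≤ 1 / (2 * (K + 1)) := min_le_right _ _
    rw [le_div_iff₀ (by positivity)] at this
    linarith
  have hpΩ : p ∈ Ω := hcl.frontier_subset hp
  obtain ⟨j, hpU, hpδ⟩ := hloc p hpΩ (by rwa [Metric.infDist_zero_of_mem hp])
  obtain ⟨T, f, hf, hb, hiff⟩ := hgraph j
  let π : EuclideanSpace ℝ (Fin (d + 1)) →ₗ[ℝ] EuclideanSpace ℝ (Fin d) :=
    { toFun := fun v => WithLp.toLp 2 fun i : Fin d => v i.castSucc
      map_add' := fun _ _ => rfl
      map_smul' := fun _ _ => rfl }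
  have hπnorm : ∀ v, ‖π v‖ ≤ ‖v‖ := fun v => by
    rw [EuclideanSpace.norm_eq, EuclideanSpace.norm_eq]
    refine Real.sqrt_le_sqrt ?_
    rw [Fin.sum_univ_castSucc]
    exact le_add_of_nonneg_right (by positivity)
  have hπc : Continuous π := π.continuous_of_finiteDimensional
  have hiff' : ∀ x ∈ U j, (x ∈ Ω ↔ T x (Fin.last d) ≤ f (π (T x))) := hiff
  have hpeq : T p (Fin.last d) = f (π (T p)) := by
    refine le_antisymm ((hiff' p hpU).1 hpΩ) ?_
    by_contra! hlt
    have hopen : IsOpen (U j ∩ {x | T x (Fin.last d) < f (π (T x))}) := by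
      refine (hU j).1.inter (isOpen_lt ?_ ?_)
      · exact (EuclideanSpace.proj (𝕜 := ℝ) (Fin.last d)).continuous.comp T.continuous
      · exact hf.continuous.comp (hπc.comp T.continuous)
    have hsub : U j ∩ {x | T x (Fin.last d) < f (π (T x))} ⊆ Ω := fun x hx =>
      (hiff' x hx.1).2 (le_of_lt hx.2)
    exact hp.2 (mem_interior.2 ⟨_, hsub, hopen, hpU, hlt⟩)
  let φ : EuclideanSpace ℝ (Fin (d + 1)) →ₗ[ℝ] ℝ :=
    ((EuclideanSpace.proj (𝕜 := ℝ) (Fin.last d)).toLinearMap -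
      (fderiv ℝ f (π (T p))).toLinearMap ∘ₗ π) ∘ₗ T.linearIsometryEquiv.toLinearMap
  set N := (InnerProductSpace.toDual ℝ (EuclideanSpace ℝ (Fin (d + 1)))).symm
    (LinearMap.toContinuousLinearMap φ) with hN
  have hNinner : ∀ v, inner ℝ N v = φ v := fun v => by
    rw [hN, InnerProductSpace.toDual_symm_apply]; rfl
  have hφ : ∀ x, φ (x - p) = T x (Fin.last d) - T p (Fin.last d) -
      fderiv ℝ f (π (T p)) (π (T x) - π (T p)) := fun x => by
    have : T.linearIsometryEquiv (x - p) = T x - T p := by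
      simpa using T.map_vsub x p
    change (T.linearIsometryEquiv (x - p)) (Fin.last d) -
      fderiv ℝ f (π (T p)) (π (T.linearIsometryEquiv (x - p))) = _
    rw [this, map_sub]; rfl
  have hN1 : 1 ≤ ‖N‖ := by
    set e := T.linearIsometryEquiv.symm (EuclideanSpace.single (Fin.last d) (1 : ℝ)) with he
    have he1 : ‖e‖ = 1 := by simp [he]
    have h1 : inner ℝ N e = 1 := by
      rw [hNinner]
      change (T.linearIsometryEquiv e) (Fin.last d) -
        fderiv ℝ f (π (T p)) (π (T.linearIsometryEquiv e)) = 1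
      have h2 : π (EuclideanSpace.single (Fin.last d) (1 : ℝ)) = 0 := by
        ext i
        change (EuclideanSpace.single (Fin.last d) (1 : ℝ)) i.castSucc = 0
        simp [(Fin.castSucc_lt_last i).ne]
      rw [he, LinearIsometryEquiv.apply_symm_apply, h2]
      simp
    have := real_inner_le_norm N e
    rwa [h1, he1, mul_one] at this
  have hN0 : 0 < ‖N‖ := by linarith
  have hinner : ∀ v, inner ℝ (‖N‖⁻¹ • N) v = ‖N‖⁻¹ * φ v := fun v => by
    rw [real_inner_smul_left, hNinner]
  have hmem : ∀ x, ∀ s : ℝ, |s| = 1 → ‖x - p‖ ^ 2 < s * (2 * r * inner ℝ (‖N‖⁻¹ • N) (x - p)) →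
      x ∈ U j ∧ K * ‖x - p‖ ^ 2 < s * φ (x - p) := by
    intro x s hs hx
    have hν : ‖‖N‖⁻¹ • N‖ = 1 := by
      rw [norm_smul, norm_inv, norm_norm, inv_mul_cancel₀ hN0.ne']
    have hsq := sq_nonneg ‖x - p‖
    constructor
    · refine ball_subset_of_lt_infDist_frontier hpU hpδ.le ?_
      rw [Metric.mem_ball, dist_eq_norm]
      have h1 := abs_real_inner_le_norm (‖N‖⁻¹ • N) (x - p)
      rw [hν, one_mul] at h1
      have h2 : s * (2 * r * inner ℝ (‖N‖⁻¹ • N) (x - p)) ≤ 2 * r * ‖x - p‖ := by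
        refine (le_abs_self _).trans ?_
        rw [abs_mul, hs, one_mul, abs_mul, abs_of_pos (by positivity : 0 < 2 * r)]
        gcongr
      have h3 : ‖x - p‖ ^ 2 < 2 * r * ‖x - p‖ := hx.trans_le h2
      by_contra! hge
      nlinarith [norm_nonneg (x - p)]
    · rw [hinner] at hx
      have h1 : ‖N‖ * ‖x - p‖ ^ 2 < 2 * r * (s * φ (x - p)) := by
        have := mul_lt_mul_of_pos_left hx hN0
        have e : ‖N‖ * (s * (2 * r * (‖N‖⁻¹ * φ (x - p)))) = 2 * r * (s * φ (x - p)) := by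
          field_simp
        rwa [e] at this
      have h2 : ‖x - p‖ ^ 2 < 2 * r * (s * φ (x - p)) := by nlinarith
      have h3 : 0 < s * φ (x - p) := by
        by_contra! hle
        nlinarith
      nlinarith
  have htaylor : ∀ x, |f (π (T x)) - f (π (T p)) - fderiv ℝ f (π (T p)) (π (T x) - π (T p))| ≤
      K * ‖x - p‖ ^ 2 := fun x => by
    refine (abs_taylor_remainder_le hM.le hf hb _ _).trans ?_
    have : ‖π (T x) - π (T p)‖ ≤ ‖x - p‖ := by
      rw [← map_sub, ← dist_eq_norm x p, ← T.dist_map x p, dist_eq_norm]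
      exact hπnorm _
    gcongr
  refine ⟨‖N‖⁻¹ • N, by rw [norm_smul, norm_inv, norm_norm, inv_mul_cancel₀ hN0.ne'],
    fun x hx => ?_, fun x hx => ?_⟩
  · obtain ⟨hxU, h1⟩ := hmem x 1 (by simp) (by rwa [one_mul])
    rw [hiff' x hxU, not_le]
    have h2 := (abs_le.1 (htaylor x)).2
    rw [hφ] at h1
    linarith
  · obtain ⟨hxU, h1⟩ := hmem x (-1) (by simp) (by rwa [neg_one_mul])
    rw [hiff' x hxU]
    have h2 := (abs_le.1 (htaylor x)).1
    rw [hφ] at h1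
    linarith

section TouchingBalls

variable {E : Type*} [NormedAddCommGroup E] [InnerProductSpace ℝ E]

/-- The power of the point `x` with respect to the sphere of radius `r` about `p + r ν`,
where `ν` is a unit vector. -/
noncomputable def spherePower (r : ℝ) (p ν x : E) : ℝ := ‖x - p‖ ^ 2 - 2 * r * inner ℝ ν (x - p)

theorem spherePower_eq {r : ℝ} {p ν : E} (hν : ‖ν‖ = 1) (x : E) :
    spherePower r p ν x = ‖x - (p + r • ν)‖ ^ 2 - r ^ 2 := by
  rw [spherePower, ← sub_sub, norm_sub_sq_real (x - p), norm_smul, hν, real_inner_smul_right,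
    real_inner_comm, mul_one, Real.norm_eq_abs, sq_abs]
  ring

theorem spherePower_eq' {r : ℝ} {p ν : E} (hν : ‖ν‖ = 1) (x : E) :
    spherePower r p ν x = 2 * ‖x - p‖ ^ 2 + r ^ 2 - ‖x - (p - r • ν)‖ ^ 2 := by
  rw [spherePower, ← sub_add, norm_add_sq_real (x - p), norm_smul, hν, real_inner_smul_right,
    real_inner_comm, mul_one, Real.norm_eq_abs, sq_abs]
  ring

theorem continuous_spherePower (r : ℝ) (p ν : E) : Continuous (spherePower r p ν) := by
  unfold spherePower; fun_prop

theorem infDist_frontier_le_of_exterior_ball [FiniteDimensional ℝ E] {Ω : Set E} {r : ℝ}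
    (hr : 0 < r) {p ν : E} (hν : ‖ν‖ = 1)
    (hext : ∀ x, ‖x - p‖ ^ 2 < 2 * r * inner ℝ ν (x - p) → x ∉ Ω) {x : E} (hx : x ∈ Ω) :
    Metric.infDist x (frontier Ω) ≤ ‖x - (p + r • ν)‖ - r := by
  by_contra! hlt
  have hball : ∀ z, dist z (p + r • ν) < r → z ∉ Ω := fun z hz => by
    refine hext z ?_
    have h1 := spherePower_eq (r := r) (p := p) hν z
    rw [dist_eq_norm] at hz
    have h2 := pow_lt_pow_left₀ hz (norm_nonneg _) two_ne_zero
    rw [spherePower] at h1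
    linarith
  have hxr : r ≤ ‖x - (p + r • ν)‖ := by
    by_contra! h
    exact hball x (by rwa [dist_eq_norm]) hx
  obtain ⟨z, hz1, hz2⟩ := exists_dist_lt_lt (x := x) (z := p + r • ν)
    (δ := Metric.infDist x (frontier Ω)) (by linarith) hr (by rw [dist_eq_norm]; linarith)
  refine hball z hz2 (ball_subset_of_lt_infDist_frontier hx le_rfl ?_)
  rwa [Metric.mem_ball, dist_comm]

theorem le_infDist_frontier_of_interior_ball {Ω : Set E} {r : ℝ}
    {p ν : E} (hν : ‖ν‖ = 1) (hp : p ∈ frontier Ω)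
    (hint : ∀ x, ‖x - p‖ ^ 2 < -(2 * r * inner ℝ ν (x - p)) → x ∈ Ω) (x : E) :
    r - ‖x - (p - r • ν)‖ ≤ Metric.infDist x (frontier Ω) := by
  refine (Metric.le_infDist ⟨p, hp⟩).2 fun q hq => ?_
  have hq' : r ≤ ‖q - (p - r • ν)‖ := by
    by_contra! h
    refine hq.2 (mem_interior.2 ⟨Metric.ball (p - r • ν) r, fun z hz => hint z ?_,
      Metric.isOpen_ball, by rwa [Metric.mem_ball, dist_eq_norm]⟩)
    rw [Metric.mem_ball, dist_eq_norm] at hz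
    have h1 := spherePower_eq' (r := r) (p := p) hν z
    have h2 := pow_lt_pow_left₀ hz (norm_nonneg _) two_ne_zero
    rw [spherePower] at h1
    linarith
  have := norm_sub_le_norm_sub_add_norm_sub q x (p - r • ν)
  rw [dist_comm, dist_eq_norm]
  linarith

theorem two_mul_infDist_le_spherePower [FiniteDimensional ℝ E] {Ω : Set E} {r : ℝ}
    (hr : 0 < r) {p ν : E} (hν : ‖ν‖ = 1)
    (hext : ∀ x, ‖x - p‖ ^ 2 < 2 * r * inner ℝ ν (x - p) → x ∉ Ω) {x : E} (hx : x ∈ Ω) :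
    2 * r * Metric.infDist x (frontier Ω) ≤ spherePower r p ν x := by
  have h1 := infDist_frontier_le_of_exterior_ball hr hν hext hx
  have h2 : 0 ≤ Metric.infDist x (frontier Ω) := Metric.infDist_nonneg
  rw [spherePower_eq hν]
  nlinarith

theorem spherePower_le {Ω : Set E} {r : ℝ} (hr : 0 < r)
    {p ν : E} (hν : ‖ν‖ = 1) (hp : p ∈ frontier Ω)
    (hint : ∀ x, ‖x - p‖ ^ 2 < -(2 * r * inner ℝ ν (x - p)) → x ∈ Ω) (x : E) :
    spherePower r p ν x ≤ 2 * r * Metric.infDist x (frontier Ω) + 2 * ‖x - p‖ ^ 2 := by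
  have h1 := le_infDist_frontier_of_interior_ball hν hp hint x
  have h2 : 0 ≤ Metric.infDist x (frontier Ω) := Metric.infDist_nonneg
  rw [spherePower_eq' hν]
  nlinarith [norm_nonneg (x - (p - r • ν)), sq_nonneg (r - ‖x - (p - r • ν)‖)]

theorem abs_spherePower_sub_le [FiniteDimensional ℝ E] {Ω : Set E} {r : ℝ} (hr : 0 < r)
    {p ν : E} (hν : ‖ν‖ = 1) (hp : p ∈ frontier Ω)
    (hext : ∀ x, ‖x - p‖ ^ 2 < 2 * r * inner ℝ ν (x - p) → x ∉ Ω)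
    (hint : ∀ x, ‖x - p‖ ^ 2 < -(2 * r * inner ℝ ν (x - p)) → x ∈ Ω) {x y : E}
    (hx : x ∈ Ω) (hy : y ∈ Ω) (hyp : Metric.infDist y (frontier Ω) = ‖y - p‖)
    (hyr : Metric.infDist y (frontier Ω) ≤ r) :
    |(spherePower r p ν x - 2 * r * Metric.infDist x (frontier Ω)) -
      (spherePower r p ν y - 2 * r * Metric.infDist y (frontier Ω))| ≤
      3 * ‖x - y‖ * (‖x - p‖ + ‖y - p‖) := by
  have hx1 := infDist_frontier_le_of_exterior_ball hr hν hext hx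
  have hy1 := infDist_frontier_le_of_exterior_ball hr hν hext hy
  have hx2 := le_infDist_frontier_of_interior_ball hν hp hint x
  have hax := spherePower_eq (r := r) (p := p) hν x
  have hay := spherePower_eq (r := r) (p := p) hν y
  have hbx := spherePower_eq' (r := r) (p := p) hν x
  have hby := spherePower_eq' (r := r) (p := p) hν y
  have hrν : ‖r • ν‖ = r := by rw [norm_smul, hν, Real.norm_of_nonneg hr.le, mul_one]
  have near_a : ∀ z, |‖z - (p + r • ν)‖ - r| ≤ ‖z - p‖ := fun z => by
    have := abs_norm_sub_norm_le (z - (p + r • ν)) (-(r • ν))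
    rwa [norm_neg, hrν, sub_neg_eq_add, ← sub_sub, sub_add_cancel, sub_sub] at this
  have near_b : ∀ z, |‖z - (p - r • ν)‖ - r| ≤ ‖z - p‖ := fun z => by
    have := abs_norm_sub_norm_le (z - (p - r • ν)) (r • ν)
    rwa [hrν, ← sub_add, add_sub_cancel_right, sub_add] at this
  have lip : ∀ c : E, |‖x - c‖ - ‖y - c‖| ≤ ‖x - y‖ := fun c => by
    simpa using abs_norm_sub_norm_le (x - c) (y - c)
  have hya := (abs_le.1 (near_a y)).2
  have hxa := near_a x
  have hya' := near_a y
  have hxb := near_b x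
  have hyb' := near_b y
  have la := lip (p + r • ν)
  have lb := lip (p - r • ν)
  have lp := lip p
  set a := ‖x - (p + r • ν)‖
  set a' := ‖y - (p + r • ν)‖
  set b := ‖x - (p - r • ν)‖
  set b' := ‖y - (p - r • ν)‖ with hb'
  set t := spherePower r p ν x
  set t' := spherePower r p ν y
  set δ := Metric.infDist x (frontier Ω)
  set δ' := Metric.infDist y (frontier Ω)
  set X := ‖x - p‖
  set Y := ‖y - p‖
  set D := ‖x - y‖
  have hD : 0 ≤ D := norm_nonneg _
  have hX : 0 ≤ X := norm_nonneg _
  have hY : 0 ≤ Y := norm_nonneg _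
  have hδa : δ' = a' - r := by linarith
  have hδb : b' = r - δ' := by
    have : b' ^ 2 = (r - δ') ^ 2 := by
      have h1 : a' = r + δ' := by linarith
      rw [← hyp, hay, h1] at hby
      linarith
    exact (pow_left_inj₀ (norm_nonneg _) (by linarith) two_ne_zero).1 this
  have prod_le : ∀ u v w : ℝ, |u| ≤ D → |v| ≤ X → |w| ≤ Y → |u * (v + w)| ≤ D * (X + Y) :=
    fun u v w hu hv hw => by
      rw [abs_mul]
      exact mul_le_mul hu ((abs_add_le _ _).trans (add_le_add hv hw)) (abs_nonneg _) hD
  have pa := abs_le.1 (prod_le _ _ _ la hxa hya')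
  have pb := abs_le.1 (prod_le _ _ _ lb hxb hyb')
  have pp := abs_le.1 (prod_le _ _ _ lp (abs_of_nonneg hX).le (abs_of_nonneg hY).le)
  have hDXY : 0 ≤ D * (X + Y) := by positivity
  rw [abs_le]
  constructor
  · have : 2 * r * (δ - δ') ≤ 2 * r * (a - a') := by
      apply mul_le_mul_of_nonneg_left _ (by positivity); linarith
    nlinarith
  · have : 2 * r * (b' - b) ≤ 2 * r * (δ - δ') := by
      apply mul_le_mul_of_nonneg_left _ (by positivity); linarith
    nlinarith

end TouchingBalls

theorem abs_sub_eq_abs_sqrt_sub_mul {a b : ℝ} (ha : 0 ≤ a) (hb : 0 ≤ b) :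
    |a - b| = |√a - √b| * (√a + √b) := by
  have h : a - b = (√a - √b) * (√a + √b) := by
    linear_combination -Real.sq_sqrt ha + Real.sq_sqrt hb
  rw [h, abs_mul, abs_of_nonneg (by positivity : 0 ≤ √a + √b)]

theorem abs_sqrt_sub_sqrt_le {a b c : ℝ} (ha : 0 ≤ a) (hc : 0 < c) (hb : c ≤ b) :
    |√a - √b| ≤ |a - b| / √c := by
  rw [le_div_iff₀ (Real.sqrt_pos.2 hc), abs_sub_eq_abs_sqrt_sub_mul ha (hc.le.trans hb)]
  gcongr
  exact (Real.sqrt_le_sqrt hb).trans (le_add_of_nonneg_left (Real.sqrt_nonneg a))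

theorem sqrt_bounds_of_bounds {r δ t X : ℝ} (hr : 0 < r) (hδ : 0 ≤ δ) (hX : 0 ≤ X)
    (h1 : 2 * r * δ ≤ t) (h2 : t ≤ 2 * r * δ + 2 * X ^ 2) :
    √(2 * r) * √δ ≤ √t ∧ √t ≤ √(2 * r) * √δ + 2 * X := by
  constructor
  · rw [← Real.sqrt_mul (by positivity)]
    exact Real.sqrt_le_sqrt h1
  · rw [Real.sqrt_le_left (by positivity)]
    have e : (√(2 * r) * √δ) ^ 2 = 2 * r * δ := by
      rw [mul_pow, Real.sq_sqrt (by positivity), Real.sq_sqrt hδ]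
    have : 0 ≤ √(2 * r) * √δ * X := by positivity
    nlinarith [sq_nonneg X]

/-- Near a boundary point `p`, the square root of the distance to the boundary varies no faster than
the square root of the power with respect to the exterior touching sphere at `p`. -/
theorem exists_abs_sqrt_infDist_sub_le {E : Type*} [NormedAddCommGroup E] [InnerProductSpace ℝ E]
    [FiniteDimensional ℝ E] {Ω : Set E} {r : ℝ} (hr : 0 < r) : ∃ C > 0, ∀ {p ν : E}, ‖ν‖ = 1 →
    p ∈ frontier Ω →
    (∀ x, ‖x - p‖ ^ 2 < 2 * r * inner ℝ ν (x - p) → x ∉ Ω) →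
    (∀ x, ‖x - p‖ ^ 2 < -(2 * r * inner ℝ ν (x - p)) → x ∈ Ω) →
    ∀ {y : E}, y ∈ Ω → Metric.infDist y (frontier Ω) = ‖y - p‖ → ∀ {x z : E}, x ∈ Ω → z ∈ Ω →
    |√(Metric.infDist x (frontier Ω)) - √(Metric.infDist z (frontier Ω))| ≤
      C * (‖x - y‖ + ‖z - y‖ + |√(spherePower r p ν x) - √(spherePower r p ν z)|) := by
  have hs : 0 < √(2 * r) := Real.sqrt_pos.2 (by positivity)
  have hsr : 0 < √r := Real.sqrt_pos.2 hr
  set C₁ := 1 / √r with hC₁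
  set C₂ := 6 / √(2 * r) + 1 / √(2 * r) with hC₂
  set C₃ := (√(2 * r) + 6 * √r + 15 / 2 * √r) / (2 * r) with hC₃
  have hC₁0 : 0 < C₁ := by positivity
  have hC₂0 : 0 < C₂ := by positivity
  have hC₃0 : 0 < C₃ := by positivity
  refine ⟨C₁ + C₂ + C₃, by positivity, ?_⟩
  intro p ν hν hp hext hint y hy hyp x z hx hz
  have hδy : 0 ≤ Metric.infDist y (frontier Ω) := Metric.infDist_nonneg
  have hδx : 0 ≤ Metric.infDist x (frontier Ω) := Metric.infDist_nonneg
  have hδz : 0 ≤ Metric.infDist z (frontier Ω) := Metric.infDist_nonneg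
  have lipδ : ∀ w, |Metric.infDist w (frontier Ω) - Metric.infDist y (frontier Ω)| ≤ ‖w - y‖ :=
    fun w => by
      have := (Metric.lipschitz_infDist_pt (frontier Ω)).dist_le_mul w y
      simpa [Real.dist_eq, dist_eq_norm] using this
  have hlx := lipδ x
  have hlz := lipδ z
  have htx1 := two_mul_infDist_le_spherePower hr hν hext hx
  have htz1 := two_mul_infDist_le_spherePower hr hν hext hz
  have htx2 := spherePower_le hr hν hp hint x
  have htz2 := spherePower_le hr hν hp hint z
  have hX : ‖x - p‖ ≤ ‖x - y‖ + ‖y - p‖ := norm_sub_le_norm_sub_add_norm_sub x y p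
  have hZ : ‖z - p‖ ≤ ‖z - y‖ + ‖y - p‖ := norm_sub_le_norm_sub_add_norm_sub z y p
  have hdiff := fun h => abs_spherePower_sub_le hr hν hp hext hint hx hy hyp h
  have hdifz := fun h => abs_spherePower_sub_le hr hν hp hext hint hz hy hyp h
  obtain ⟨hsx1, hsx2⟩ := sqrt_bounds_of_bounds hr hδx (norm_nonneg _) htx1 htx2
  obtain ⟨hsz1, hsz2⟩ := sqrt_bounds_of_bounds hr hδz (norm_nonneg _) htz1 htz2
  have htx0 : 0 ≤ spherePower r p ν x := le_trans (by positivity) htx1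
  have htz0 : 0 ≤ spherePower r p ν z := le_trans (by positivity) htz1
  rw [← hyp] at hX hZ hdiff hdifz
  have hX0 := norm_nonneg (x - p)
  have hZ0 := norm_nonneg (z - p)
  have he0 := norm_nonneg (x - y)
  have he'0 := norm_nonneg (z - y)
  set δx := Metric.infDist x (frontier Ω)
  set δz := Metric.infDist z (frontier Ω)
  set η := Metric.infDist y (frontier Ω)
  set t := spherePower r p ν x
  set t' := spherePower r p ν z
  set X := ‖x - p‖
  set Z := ‖z - p‖
  set e := ‖x - y‖
  set e' := ‖z - y‖
  set V := |√t - √t'| with hV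
  have hV0 : 0 ≤ V := abs_nonneg _
  clear_value δx δz η t t' X Z e e'
  have hsum0 : 0 ≤ e + e' + V := by positivity
  have split : ∀ w : ℝ, (w ≤ C₁ * (e + e' + V) ∨ w ≤ C₂ * (e + e' + V) ∨ w ≤ C₃ * (e + e' + V)) →
      w ≤ (C₁ + C₂ + C₃) * (e + e' + V) := fun w hw => by
    have := mul_nonneg hC₁0.le hsum0
    have := mul_nonneg hC₂0.le hsum0
    have := mul_nonneg hC₃0.le hsum0
    rcases hw with h | h | h <;> linarith
  refine split _ ?_
  by_cases hdeep : r < η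
  · left
    have h1 := abs_sqrt_sub_sqrt_le hδx hr hdeep.le
    have h2 := abs_sqrt_sub_sqrt_le hδz hr hdeep.le
    have h3 := abs_sub_le (√δx) (√η) (√δz)
    rw [abs_sub_comm (√η)] at h3
    calc _ ≤ _ := h3
      _ ≤ e / √r + e' / √r := by
          exact add_le_add (h1.trans (by gcongr)) (h2.trans (by gcongr))
      _ = C₁ * (e + e') := by rw [hC₁]; ring
      _ ≤ C₁ * (e + e' + V) := mul_le_mul_of_nonneg_left (by linarith) hC₁0.le
  push Not at hdeep
  right
  by_cases hfar : η ≤ 2 * (e + e')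
  · left
    have hV1 := abs_le.1 hV.ge
    have h1 : √(2 * r) * |√δx - √δz| ≤ 6 * (e + e') + V := by
      have : √(2 * r) * |√δx - √δz| = |√(2 * r) * (√δx - √δz)| := by rw [abs_mul, abs_of_pos hs]
      rw [this, mul_sub, abs_le]
      constructor <;> linarith
    have h2 : |√δx - √δz| ≤ (6 * (e + e') + V) / √(2 * r) := by
      rw [le_div_iff₀ hs]; linarith
    refine h2.trans ?_
    rw [div_le_iff₀ hs, hC₂]
    have : (6 / √(2 * r) + 1 / √(2 * r)) * (e + e' + V) * √(2 * r) = 7 * (e + e' + V) := by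
      field_simp; ring
    rw [this]
    linarith
  · right
    push Not at hfar
    have hη0 : 0 < η := by linarith
    set S := √δx + √δz with hS
    have hS2 : η ≤ S ^ 2 := by
      have h1 := (abs_le.1 hlx).1
      have h2 := (abs_le.1 hlz).1
      have h3 := Real.sq_sqrt hδx
      have h4 := Real.sq_sqrt hδz
      have h5 : 0 ≤ √δx * √δz := by positivity
      nlinarith
    have hS0 : 0 < S := by
      have : 0 ≤ S := by positivity
      rcases this.eq_or_lt with h | h
      · rw [← h] at hS2; norm_num at hS2; linarith
      · exact h
    have hηS : η ≤ √r * S := by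
      have h1 : √η ≤ S := by rw [Real.sqrt_le_left hS0.le]; exact hS2
      calc η = √η * √η := (Real.mul_self_sqrt hη0.le).symm
        _ ≤ √r * S := by gcongr
    have hd1 := abs_le.1 (hdiff hdeep)
    have hd2 := abs_le.1 (hdifz hdeep)
    have hX' : X + η ≤ 5 / 2 * η := by linarith
    have hZ' : Z + η ≤ 5 / 2 * η := by linarith
    have hp1 : 3 * e * (X + η) ≤ 3 * e * (5 / 2 * η) := by gcongr
    have hp2 : 3 * e' * (Z + η) ≤ 3 * e' * (5 / 2 * η) := by gcongr
    have hkey : 2 * r * |δx - δz| ≤ |t - t'| + 15 / 2 * (e + e') * η := by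
      have : 2 * r * |δx - δz| = |2 * r * (δx - δz)| := by
        rw [abs_mul, abs_of_pos (by positivity : 0 < 2 * r)]
      rw [this, abs_le]
      have := le_abs_self (t - t')
      have := neg_abs_le (t - t')
      constructor <;> linarith
    have ht : |t - t'| = V * (√t + √t') := abs_sub_eq_abs_sqrt_sub_mul htx0 htz0
    have hδ : |δx - δz| = |√δx - √δz| * S := abs_sub_eq_abs_sqrt_sub_mul hδx hδz
    have hT : √t + √t' ≤ (√(2 * r) + 6 * √r) * S := by
      have : √(2 * r) * S = √(2 * r) * √δx + √(2 * r) * √δz := by rw [hS]; ring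
      linarith
    rw [hδ, ht] at hkey
    have hfin : 2 * r * |√δx - √δz| * S ≤
        (V * (√(2 * r) + 6 * √r) + 15 / 2 * (e + e') * √r) * S := by
      have h1 := mul_le_mul_of_nonneg_left hT hV0
      have h2 : 15 / 2 * (e + e') * η ≤ 15 / 2 * (e + e') * (√r * S) := by gcongr
      linarith
    have hfin2 := le_of_mul_le_mul_right hfin hS0
    rw [hC₃, div_mul_eq_mul_div, le_div_iff₀ (by positivity)]
    have : 0 ≤ (√(2 * r) + 6 * √r) * (e + e') := by positivity
    have : 0 ≤ 15 / 2 * √r * V := by positivity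
    linarith

theorem MvPolynomial.totalDegree_polynomial_aeval_le {σ : Type*} (g : MvPolynomial σ ℝ)
    (p : Polynomial ℝ) :
    (Polynomial.aeval g p).totalDegree ≤ p.natDegree * g.totalDegree := by
  rw [Polynomial.aeval_eq_sum_range]
  refine MvPolynomial.totalDegree_finsetSum_le fun i hi => ?_
  refine (MvPolynomial.totalDegree_smul_le _ _).trans ((MvPolynomial.totalDegree_pow _ _).trans ?_)
  exact Nat.mul_le_mul_right _ (Nat.lt_succ_iff.1 (Finset.mem_range.1 hi))

theorem MvPolynomial.eval_polynomial_aeval {σ : Type*} (x : σ → ℝ) (g : MvPolynomial σ ℝ)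
    (p : Polynomial ℝ) :
    MvPolynomial.eval x (Polynomial.aeval g p) = p.eval (MvPolynomial.eval x g) := by
  induction p using Polynomial.induction_on' with
  | add p q hp hq => simp [hp, hq]
  | monomial n a => simp [Polynomial.aeval_monomial, MvPolynomial.algebraMap_eq]

theorem exists_polynomial_eq_spherePower {d : ℕ} (r L : ℝ) (p ν : EuclideanSpace ℝ (Fin d)) :
    ∃ g : MvPolynomial (Fin d) ℝ, g.totalDegree ≤ 2 ∧
      ∀ x : EuclideanSpace ℝ (Fin d),
        MvPolynomial.eval (fun i => x i) g = spherePower r p ν x / L := by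
  refine ⟨MvPolynomial.C L⁻¹ * ∑ s, ((MvPolynomial.X s - MvPolynomial.C (p s)) ^ 2 -
    MvPolynomial.C (2 * r * ν s) * (MvPolynomial.X s - MvPolynomial.C (p s))), ?_, fun x => ?_⟩
  · have hX : ∀ s : Fin d, (MvPolynomial.X s - MvPolynomial.C (p s) :
        MvPolynomial (Fin d) ℝ).totalDegree ≤ 1 := fun s => by
      refine (MvPolynomial.totalDegree_sub _ _).trans ?_
      simp [MvPolynomial.totalDegree_X]
    refine (MvPolynomial.totalDegree_mul _ _).trans ?_
    rw [MvPolynomial.totalDegree_C, zero_add]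
    refine MvPolynomial.totalDegree_finsetSum_le fun s _ => ?_
    refine (MvPolynomial.totalDegree_sub _ _).trans (max_le ?_ ?_)
    · exact (MvPolynomial.totalDegree_pow _ _).trans (Nat.mul_le_mul_left 2 (hX s))
    · refine (MvPolynomial.totalDegree_mul _ _).trans ?_
      rw [MvPolynomial.totalDegree_C, zero_add]
      exact (hX s).trans one_le_two
  · have h1 : inner ℝ ν (x - p) = ∑ s, ν s * (x s - p s) := by
      rw [PiLp.inner_apply]
      exact Finset.sum_congr rfl fun s _ => by simp [mul_comm]
    rw [spherePower, EuclideanSpace.norm_sq_eq, h1, Finset.mul_sum _ _ (2 * r),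
      ← Finset.sum_sub_distrib]
    simp only [map_mul, map_sum, map_sub, map_pow, MvPolynomial.eval_C, MvPolynomial.eval_X]
    rw [inv_mul_eq_div]
    congr 1
    refine Finset.sum_congr rfl fun s _ => ?_
    simp only [PiLp.sub_apply, Real.norm_eq_abs, sq_abs]
    ring

theorem one_add_sum_le_prod_one_add {ι : Type*} (s : Finset ι) (f : ι → ℝ)
    (hf : ∀ i ∈ s, 0 ≤ f i) : 1 + ∑ i ∈ s, f i ≤ ∏ i ∈ s, (1 + f i) := by
  classical
  induction s using Finset.induction_on with
  | empty => simp
  | insert a s ha ih =>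
    rw [Finset.sum_insert ha, Finset.prod_insert ha]
    have h1 := ih fun i hi => hf i (Finset.mem_insert_of_mem hi)
    have h2 := hf a (Finset.mem_insert_self a s)
    have h3 : 0 ≤ ∑ i ∈ s, f i := Finset.sum_nonneg fun i hi => hf i (Finset.mem_insert_of_mem hi)
    nlinarith

theorem exists_separated_finset {ι : Type*} [Fintype ι] (ρ : ι → ι → ℝ) {ε : ℝ}
    (hsymm : ∀ a b, ρ a b = ρ b a) (hself : ∀ a, ρ a a < ε) :
    ∃ s : Finset ι, (∀ a ∈ s, ∀ b ∈ s, a ≠ b → ε ≤ ρ a b) ∧ ∀ a, ∃ b ∈ s, ρ a b < ε := by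
  classical
  obtain ⟨s, hs, hmax⟩ := Finset.exists_max_image
    ((Finset.univ : Finset (Finset ι)).filter fun s => ∀ a ∈ s, ∀ b ∈ s, a ≠ b → ε ≤ ρ a b)
    Finset.card ⟨∅, by simp⟩
  have hsep := (Finset.mem_filter.1 hs).2
  refine ⟨s, hsep, fun a => ?_⟩
  by_contra! h
  have ha : a ∉ s := fun ha => absurd (hself a) (not_lt.2 (h a ha))
  have := hmax (insert a s) (Finset.mem_filter.2 ⟨Finset.mem_univ _, fun b hb c hc hbc => ?_⟩)
  · rw [Finset.card_insert_of_notMem ha] at this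
    omega
  · rw [Finset.mem_insert] at hb hc
    rcases hb with rfl | hb <;> rcases hc with rfl | hc
    · exact absurd rfl hbc
    · exact h c hc
    · rw [hsymm]; exact h b hb
    · exact hsep b hb c hc hbc

section RhoMetric

variable {d : ℕ} (Ω : Set (EuclideanSpace ℝ (Fin (d + 1))))

theorem rhoMetric_comm (x y : EuclideanSpace ℝ (Fin (d + 1))) :
    rhoMetric Ω x y = rhoMetric Ω y x := by
  unfold rhoMetric
  rw [norm_sub_rev, abs_sub_comm]

theorem rhoMetric_self (x : EuclideanSpace ℝ (Fin (d + 1))) : rhoMetric Ω x x = 0 := by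
  simp [rhoMetric]

theorem rhoMetric_nonneg (x y : EuclideanSpace ℝ (Fin (d + 1))) : 0 ≤ rhoMetric Ω x y := by
  unfold rhoMetric; positivity

theorem rhoMetric_triangle (x y z : EuclideanSpace ℝ (Fin (d + 1))) :
    rhoMetric Ω x z ≤ rhoMetric Ω x y + rhoMetric Ω y z := by
  unfold rhoMetric
  have h1 := norm_sub_le_norm_sub_add_norm_sub x y z
  have h2 := abs_sub_le (√(Metric.infDist x (frontier Ω))) (√(Metric.infDist y (frontier Ω)))
    (√(Metric.infDist z (frontier Ω)))
  linarith

end RhoMetric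

/-- A localized polynomial partition of unity on a compact set with the two-sided ball condition;
the localization is measured by a weighted sum, and the centres need not be separated. -/
theorem exists_localized_partition {d : ℕ} {Ω : Set (EuclideanSpace ℝ (Fin (d + 1)))} {r : ℝ}
    (hΩ : IsCompact Ω) (hne : Ω.Nonempty) (hr : 0 < r) (hballs : HasTwoSidedBalls Ω r) (m : ℕ) :
    ∃ (A : ℕ) (C : ℝ), 0 < A ∧ 0 < C ∧ ∀ n : ℕ, 0 < n →
      ∃ (ι : Type) (_ : Fintype ι) (ξ : ι → EuclideanSpace ℝ (Fin (d + 1)))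
        (P : ι → MvPolynomial (Fin (d + 1)) ℝ), (∀ a, ξ a ∈ Ω) ∧
        (∀ a, (P a).totalDegree ≤ A * n) ∧
        (∀ x ∈ Ω, ∑ a, MvPolynomial.eval (fun i => x i) (P a) = 1) ∧
        ∀ x ∈ Ω, ∑ a, |MvPolynomial.eval (fun i => x i) (P a)| *
          (1 + n * rhoMetric Ω x (ξ a)) ^ m ≤ C := by
  obtain ⟨A₁, C₁, hC₁, h₁⟩ := exists_polynomial_partition m
  obtain ⟨A₂, C₂, hC₂, h₂⟩ := exists_polynomial_partition_sqrt m
  obtain ⟨C₃, hC₃, h₃⟩ := exists_abs_sqrt_infDist_sub_le (Ω := Ω) hr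
  obtain ⟨R, hR, hΩR⟩ := hΩ.isBounded.exists_pos_norm_le
  have hfr : (frontier Ω).Nonempty := by
    refine nonempty_frontier_iff.2 ⟨hne, fun h => ?_⟩
    exact NormedSpace.noncompactSpace ℝ (EuclideanSpace ℝ (Fin (d + 1))) |>.noncompact_univ (h ▸ hΩ)
  set L := 16 * (R ^ 2 + r * R) with hL
  have hL0 : 0 < L := by positivity
  set B := 2 * (1 + C₃ * (1 + √L)) * (4 * R + 1) with hB
  have hB0 : 0 < B := by positivity
  refine ⟨(d + 1) * A₁ + A₂ * 2 + 1, (1 + B) ^ m * (C₁ ^ (d + 1) * C₂), by omega, by positivity,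
    fun n hn => ?_⟩
  have hn0 : (0 : ℝ) < n := by exact_mod_cast hn
  obtain ⟨p, c, hpdeg, hpsum, hp⟩ := h₁ n hn
  obtain ⟨q, c', hqdeg, hqsum, hq⟩ := h₂ n hn
  -- the grid, the nearest points of `Ω` and of its boundary, and the normals there
  let grid : (Fin (d + 1) → Fin n) → EuclideanSpace ℝ (Fin (d + 1)) :=
    fun i => WithLp.toLp 2 fun s => 2 * R * c (i s)
  choose y hyΩ hy using fun i => hΩ.exists_infDist_eq_dist hne (grid i)
  choose b hbΓ hb using fun i => isClosed_frontier.exists_infDist_eq_dist hfr (y i)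
  choose ν hν hext hint using fun i => hballs (b i) (hbΓ i)
  have hbΩ : ∀ i, b i ∈ Ω := fun i => hΩ.isClosed.frontier_subset (hbΓ i)
  set t : (Fin (d + 1) → Fin n) → EuclideanSpace ℝ (Fin (d + 1)) → ℝ :=
    fun i => spherePower r (b i) (ν i) with ht
  have ht0 : ∀ i, ∀ x ∈ Ω, 0 ≤ t i x := fun i x hx =>
    le_trans (by positivity [Metric.infDist_nonneg (x := x) (s := frontier Ω)])
      (two_mul_infDist_le_spherePower hr (hν i) (hext i) hx)
  have htL : ∀ i, ∀ x ∈ Ω, t i x / L ∈ Set.Icc (0 : ℝ) (1 / 4) := fun i x hx => by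
    refine ⟨div_nonneg (ht0 i x hx) hL0.le, ?_⟩
    rw [div_le_iff₀ hL0, ht]
    have h1 : ‖x - b i‖ ≤ 2 * R := by
      linarith [norm_sub_le x (b i), hΩR x hx, hΩR _ (hbΩ i)]
    have h2 := (abs_le.1 (abs_real_inner_le_norm (ν i) (x - b i))).1
    rw [hν, one_mul] at h2
    have h3 : ‖x - b i‖ ^ 2 ≤ (2 * R) ^ 2 := pow_le_pow_left₀ (norm_nonneg _) h1 2
    have h4 : -(2 * r * inner ℝ (ν i) (x - b i)) ≤ 2 * r * (2 * R) := by
      rw [← mul_neg]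
      exact mul_le_mul_of_nonneg_left (by linarith) (by positivity)
    simp only [spherePower]
    linarith
  let Φ : (Fin (d + 1) → Fin n) × Fin n → EuclideanSpace ℝ (Fin (d + 1)) → ℝ :=
    fun a x => ‖x - y a.1‖ + |√(t a.1 x / L) - c' a.2|
  have hΦc : ∀ a, Continuous (Φ a) := fun a => by
    have := continuous_spherePower r (b a.1) (ν a.1)
    simp only [Φ, ht]
    fun_prop
  choose ξ hξΩ hξ using fun a => hΩ.exists_isMinOn hne (hΦc a).continuousOn
  choose g hgdeg hg using fun i => exists_polynomial_eq_spherePower r L (b i) (ν i)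
  let Q : (Fin (d + 1) → Fin n) → MvPolynomial (Fin (d + 1)) ℝ := fun i =>
    ∏ s, Polynomial.aeval (MvPolynomial.C (2 * R)⁻¹ * MvPolynomial.X s) (p (i s))
  have hQ : ∀ i (x : EuclideanSpace ℝ (Fin (d + 1))), MvPolynomial.eval (fun i => x i) (Q i) =
      ∏ s, (p (i s)).eval ((2 * R)⁻¹ * x s) := fun i x => by
    simp only [Q, map_prod, MvPolynomial.eval_polynomial_aeval, map_mul, MvPolynomial.eval_C,
      MvPolynomial.eval_X]
  have hP : ∀ i k (x : EuclideanSpace ℝ (Fin (d + 1))),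
      MvPolynomial.eval (fun i => x i) (Q i * Polynomial.aeval (g i) (q k)) =
      (∏ s, (p (i s)).eval ((2 * R)⁻¹ * x s)) * (q k).eval (t i x / L) := fun i k x => by
    rw [map_mul, hQ, MvPolynomial.eval_polynomial_aeval, hg]
  have expand : ∀ F : Fin (d + 1) → Fin n → ℝ, ∑ i : Fin (d + 1) → Fin n, ∏ s, F s (i s) =
      ∏ s, ∑ k, F s k := fun F => by
    rw [Finset.prod_univ_sum, Fintype.piFinset_univ]
  refine ⟨(Fin (d + 1) → Fin n) × Fin n, inferInstance, ξ,
    fun a => Q a.1 * Polynomial.aeval (g a.1) (q a.2), hξΩ, fun a => ?_, fun x hx => ?_,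
    fun x hx => ?_⟩
  · refine (MvPolynomial.totalDegree_mul _ _).trans ?_
    have h1 : (Q a.1).totalDegree ≤ (d + 1) * (A₁ * n) := by
      refine (MvPolynomial.totalDegree_finsetProd _ _).trans ?_
      refine (Finset.sum_le_card_nsmul _ _ (A₁ * n) fun s _ => ?_).trans (by simp)
      refine (MvPolynomial.totalDegree_polynomial_aeval_le _ _).trans ?_
      have : (MvPolynomial.C (2 * R)⁻¹ * MvPolynomial.X s :
          MvPolynomial (Fin (d + 1)) ℝ).totalDegree ≤ 1 := by
        refine (MvPolynomial.totalDegree_mul _ _).trans ?_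
        rw [MvPolynomial.totalDegree_C, MvPolynomial.totalDegree_X]
      calc _ ≤ (A₁ * n) * 1 := Nat.mul_le_mul (hpdeg _) this
        _ = _ := mul_one _
    have h2 : (Polynomial.aeval (g a.1) (q a.2)).totalDegree ≤ (A₂ * n) * 2 :=
      (MvPolynomial.totalDegree_polynomial_aeval_le _ _).trans (Nat.mul_le_mul (hqdeg _) (hgdeg _))
    calc _ ≤ (d + 1) * (A₁ * n) + (A₂ * n) * 2 := add_le_add h1 h2
      _ ≤ _ := by nlinarith
  · simp only [hP]
    rw [Fintype.sum_prod_type]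
    simp only [← Finset.mul_sum, hqsum _ (htL _ x hx).1, mul_one]
    rw [expand fun s k => (p k).eval ((2 * R)⁻¹ * x s)]
    simp [hpsum]
  · set w : Fin (d + 1) → Fin n → ℝ := fun s k => 1 + n * |(2 * R)⁻¹ * x s - c k| with hw
    set v : (Fin (d + 1) → Fin n) → Fin n → ℝ := fun i k => 1 + n * |√(t i x / L) - c' k| with hv
    have hxs : ∀ s, (2 * R)⁻¹ * x s ∈ Set.Icc (-1 / 2 : ℝ) (1 / 2) := fun s => by
      have h1 := abs_le.1 ((PiLp.norm_apply_le x s).trans (hΩR x hx))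
      rw [inv_mul_eq_div]
      constructor
      · rw [le_div_iff₀ (by positivity)]; linarith
      · rw [div_le_iff₀ (by positivity)]; linarith
    have hρ : ∀ a, 1 + n * rhoMetric Ω x (ξ a) ≤ (1 + B) * ((∏ s, w s (a.1 s)) * v a.1 a.2) := by
      rintro ⟨i, k⟩
      have hmin : Φ (i, k) (ξ (i, k)) ≤ Φ (i, k) x := hξ (i, k) hx
      set z := ξ (i, k) with hz
      have hzΩ : z ∈ Ω := hξΩ _
      have e1 := h₃ (hν i) (hbΓ i) (hext i) (hint i) (hyΩ i)
        (by rw [hb, dist_eq_norm]) hx hzΩ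
      have e2 : |√(t i x) - √(t i z)| ≤
          √L * (|√(t i x / L) - c' k| + |√(t i z / L) - c' k|) := by
        have hsL : 0 < √L := Real.sqrt_pos.2 hL0
        have : √(t i x) - √(t i z) = √L * (√(t i x / L) - √(t i z / L)) := by
          rw [Real.sqrt_div (ht0 i x hx), Real.sqrt_div (ht0 i z hzΩ)]
          field_simp
        rw [this, abs_mul, abs_of_pos hsL]
        gcongr
        have := abs_sub_le (√(t i x / L)) (c' k) (√(t i z / L))
        rwa [abs_sub_comm (c' k)] at this
      have e3 : ‖x - z‖ ≤ ‖x - y i‖ + ‖z - y i‖ := by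
        have := norm_sub_le_norm_sub_add_norm_sub x (y i) z
        rwa [norm_sub_rev (y i)] at this
      have e4 : ‖x - y i‖ ≤ 2 * ‖x - grid i‖ := by
        have h1 := norm_sub_le_norm_sub_add_norm_sub x (grid i) (y i)
        have h2 : ‖grid i - y i‖ ≤ ‖x - grid i‖ := by
          rw [← dist_eq_norm, ← hy, norm_sub_rev, ← dist_eq_norm]
          exact Metric.infDist_le_dist_of_mem hx
        linarith
      have e5 : ‖x - grid i‖ ≤ 2 * R * ∑ s, |(2 * R)⁻¹ * x s - c (i s)| := by
        rw [EuclideanSpace.norm_eq, Finset.mul_sum]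
        have h1 : ∀ s, ‖(x - grid i) s‖ = 2 * R * |(2 * R)⁻¹ * x s - c (i s)| := fun s => by
          have : (x - grid i) s = 2 * R * ((2 * R)⁻¹ * x s - c (i s)) := by
            simp only [grid, PiLp.sub_apply]
            field_simp
          rw [this, Real.norm_eq_abs, abs_mul, abs_of_pos (by positivity : 0 < 2 * R)]
        simp only [h1]
        rw [Real.sqrt_le_left (Finset.sum_nonneg fun s _ => by positivity)]
        exact Finset.sum_sq_le_sq_sum_of_nonneg fun s _ => by positivity
      set S := ∑ s, |(2 * R)⁻¹ * x s - c (i s)| with hS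
      have hS0 : 0 ≤ S := Finset.sum_nonneg fun s _ => abs_nonneg _
      set τ := |√(t i x / L) - c' k| with hτ
      have hτ0 : 0 ≤ τ := abs_nonneg _
      have hmin' : ‖z - y i‖ + |√(t i z / L) - c' k| ≤ ‖x - y i‖ + τ := hmin
      have e6 : ‖x - y i‖ + τ ≤ (4 * R + 1) * (S + τ) := by nlinarith
      have e7 : rhoMetric Ω x z ≤ B * (S + τ) := by
        have hsL : 0 ≤ √L := Real.sqrt_nonneg L
        have n1 := norm_nonneg (x - y i)
        have n2 := norm_nonneg (z - y i)
        have n3 := abs_nonneg (√(t i z / L) - c' k)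
        set T := (‖x - y i‖ + τ) + (‖z - y i‖ + |√(t i z / L) - c' k|) with hT
        have f1 : ‖x - y i‖ + ‖z - y i‖ + |√(t i x) - √(t i z)| ≤ (1 + √L) * T := by
          refine (add_le_add_right e2 _).trans ?_
          have : 0 ≤ √L * (‖x - y i‖ + ‖z - y i‖) := by positivity
          linarith
        have f2 : rhoMetric Ω x z ≤ (1 + C₃ * (1 + √L)) * T := by
          unfold rhoMetric
          have := mul_le_mul_of_nonneg_left f1 hC₃.le
          linarith
        calc _ ≤ _ := f2
          _ ≤ (1 + C₃ * (1 + √L)) * (2 * ((4 * R + 1) * (S + τ))) := by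
              gcongr
              linarith
          _ = B * (S + τ) := by rw [hB]; ring
      have e8 : 1 + n * S ≤ ∏ s, w s (i s) := by
        rw [hS, Finset.mul_sum]
        exact one_add_sum_le_prod_one_add _ _ fun s _ => by positivity
      have e9 : 1 + n * S + n * τ ≤ (∏ s, w s (i s)) * v i k := by
        have h1 : 0 ≤ n * S := by positivity
        have h2 : 0 ≤ n * τ := by positivity
        calc 1 + n * S + n * τ ≤ (1 + n * S) * (1 + n * τ) := by nlinarith
          _ ≤ _ := mul_le_mul_of_nonneg_right e8 (by positivity)
      calc 1 + n * rhoMetric Ω x z ≤ 1 + n * (B * (S + τ)) := by gcongr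
        _ ≤ (1 + B) * (1 + n * S + n * τ) := by
            have h1 : 0 ≤ n * S := by positivity
            have h2 : 0 ≤ n * τ := by positivity
            nlinarith
        _ ≤ _ := by gcongr
    have hterm : ∀ a : (Fin (d + 1) → Fin n) × Fin n,
        |(∏ s, (p (a.1 s)).eval ((2 * R)⁻¹ * x s)) * (q a.2).eval (t a.1 x / L)| *
          (1 + n * rhoMetric Ω x (ξ a)) ^ m ≤
        (1 + B) ^ m * ((∏ s, |(p (a.1 s)).eval ((2 * R)⁻¹ * x s)| * w s (a.1 s) ^ m) *
          (|(q a.2).eval (t a.1 x / L)| * v a.1 a.2 ^ m)) := fun a => by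
      have h0 : 0 ≤ 1 + n * rhoMetric Ω x (ξ a) := by
        have := rhoMetric_nonneg Ω x (ξ a)
        positivity
      refine (mul_le_mul_of_nonneg_left (pow_le_pow_left₀ h0 (hρ a) m) (abs_nonneg _)).trans_eq ?_
      rw [abs_mul, Finset.abs_prod, Finset.prod_mul_distrib, Finset.prod_pow, mul_pow, mul_pow]
      ring
    simp only [hP]
    refine (Finset.sum_le_sum fun a _ => hterm a).trans ?_
    rw [← Finset.mul_sum, Fintype.sum_prod_type]
    refine mul_le_mul_of_nonneg_left ?_ (by positivity)
    simp only [← Finset.mul_sum]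
    have hw0 : ∀ s k, 0 ≤ w s k := fun s k => by positivity
    have hwm : ∀ s k, 0 ≤ |(p k).eval ((2 * R)⁻¹ * x s)| * w s k ^ m := fun s k =>
      mul_nonneg (abs_nonneg _) (pow_nonneg (hw0 _ _) _)
    have hq' : ∀ i, ∑ k, |(q k).eval (t i x / L)| * v i k ^ m ≤ C₂ := fun i => hq _ (htL i x hx)
    have hp' : ∀ s, ∑ k, |(p k).eval ((2 * R)⁻¹ * x s)| * w s k ^ m ≤ C₁ := fun s => hp _ (hxs s)
    refine (Finset.sum_le_sum fun i _ => mul_le_mul_of_nonneg_left (hq' i)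
      (Finset.prod_nonneg fun s _ => hwm s (i s))).trans ?_
    rw [← Finset.sum_mul, expand fun s k => |(p k).eval ((2 * R)⁻¹ * x s)| * w s k ^ m]
    refine mul_le_mul_of_nonneg_right ?_ hC₂.le
    refine (Finset.prod_le_prod (fun s _ => Finset.sum_nonneg fun k _ => hwm s k)
      fun s _ => hp' s).trans_eq ?_
    simp

theorem exists_rhoMetric_le {d : ℕ} {Ω : Set (EuclideanSpace ℝ (Fin (d + 1)))}
    (hΩ : IsCompact Ω) : ∃ D > 0, ∀ x ∈ Ω, ∀ y ∈ Ω, rhoMetric Ω x y ≤ D := by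
  have hc : Continuous fun x : EuclideanSpace ℝ (Fin (d + 1)) =>
      ‖x‖ + √(Metric.infDist x (frontier Ω)) := by
    have := Metric.continuous_infDist_pt (frontier Ω)
    fun_prop
  obtain ⟨D, hD⟩ := hΩ.exists_bound_of_continuousOn hc.continuousOn
  refine ⟨2 * |D| + 1, by positivity, fun x hx y hy => ?_⟩
  have h1 := (le_abs_self _).trans (hD x hx)
  have h2 := (le_abs_self _).trans (hD y hy)
  have h3 := norm_sub_le x y
  have h4 : |√(Metric.infDist x (frontier Ω)) - √(Metric.infDist y (frontier Ω))| ≤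
      √(Metric.infDist x (frontier Ω)) + √(Metric.infDist y (frontier Ω)) := by
    rw [abs_le]
    constructor <;> linarith [Real.sqrt_nonneg (Metric.infDist x (frontier Ω)),
      Real.sqrt_nonneg (Metric.infDist y (frontier Ω))]
  unfold rhoMetric
  linarith [le_abs_self D]

/-- Merging a localized partition of unity along a maximal `1 / n`-separated set of centres. -/
theorem exists_separated_partition {d : ℕ} {Ω : Set (EuclideanSpace ℝ (Fin (d + 1)))}
    {ι : Type} [Fintype ι] {m N n : ℕ} {C : ℝ} {k : ℕ} (hn : 0 < n) (hkn : k ≤ n)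
    (ξ : ι → EuclideanSpace ℝ (Fin (d + 1))) (P : ι → MvPolynomial (Fin (d + 1)) ℝ)
    (hξ : ∀ a, ξ a ∈ Ω) (hdeg : ∀ a, (P a).totalDegree ≤ N)
    (hsum : ∀ x ∈ Ω, ∑ a, MvPolynomial.eval (fun i => x i) (P a) = 1)
    (hloc : ∀ x ∈ Ω, ∑ a, |MvPolynomial.eval (fun i => x i) (P a)| *
      (1 + k * rhoMetric Ω x (ξ a)) ^ m ≤ C) :
    ∃ (M : ℕ) (ζ : Fin M → EuclideanSpace ℝ (Fin (d + 1)))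
      (Q : Fin M → MvPolynomial (Fin (d + 1)) ℝ), (∀ j, ζ j ∈ Ω) ∧
      (∀ i j, i ≠ j → 1 / (n : ℝ) ≤ rhoMetric Ω (ζ i) (ζ j)) ∧
      (∀ j, (Q j).totalDegree ≤ N) ∧
      (∀ x ∈ Ω, ∑ j, MvPolynomial.eval (fun i => x i) (Q j) = 1) ∧
      ∀ x ∈ Ω, ∀ j, |MvPolynomial.eval (fun i => x i) (Q j)| *
        (1 + k * rhoMetric Ω x (ζ j)) ^ m ≤ 2 ^ m * C := by
  classical
  have hn0 : (0 : ℝ) < n := by exact_mod_cast hn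
  obtain ⟨s, hsep, hcov⟩ := exists_separated_finset (fun a b => rhoMetric Ω (ξ a) (ξ b))
    (ε := 1 / (n : ℝ)) (fun a b => rhoMetric_comm Ω _ _)
    (fun a => by rw [rhoMetric_self]; positivity)
  choose g hgs hg using hcov
  have hsumQ : ∀ x, ∑ j : Fin s.card, MvPolynomial.eval x
      (∑ a ∈ Finset.univ.filter fun a => g a = s.equivFin.symm j, P a) =
      ∑ a, MvPolynomial.eval x (P a) := fun x => by
    simp only [map_sum]
    rw [Equiv.sum_comp s.equivFin.symm fun b : s =>
      ∑ a ∈ Finset.univ.filter fun a => g a = b, MvPolynomial.eval x (P a),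
      Finset.sum_coe_sort s fun b =>
      ∑ a ∈ Finset.univ.filter fun a => g a = b, MvPolynomial.eval x (P a)]
    exact Finset.sum_fiberwise_of_maps_to (fun a _ => hgs a) _
  refine ⟨s.card, fun j => ξ (s.equivFin.symm j),
    fun j => ∑ a ∈ Finset.univ.filter fun a => g a = s.equivFin.symm j, P a,
    fun j => hξ _, fun i j hij => ?_, fun j => ?_, fun x hx => ?_, fun x hx j => ?_⟩
  · refine hsep _ (s.equivFin.symm i).2 _ (s.equivFin.symm j).2 fun h => hij ?_
    exact s.equivFin.symm.injective (Subtype.ext h)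
  · exact MvPolynomial.totalDegree_finsetSum_le fun a _ => hdeg a
  · rw [hsumQ, hsum x hx]
  · have hρ := rhoMetric_nonneg Ω x
    rw [map_sum]
    calc _ ≤ (∑ a ∈ Finset.univ.filter fun a => g a = s.equivFin.symm j,
          |MvPolynomial.eval (fun i => x i) (P a)|) *
          (1 + k * rhoMetric Ω x (ξ (s.equivFin.symm j))) ^ m := by
          have := hρ (ξ (s.equivFin.symm j))
          gcongr
          exact Finset.abs_sum_le_sum_abs _ _
      _ ≤ ∑ a ∈ Finset.univ.filter fun a => g a = s.equivFin.symm j,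
          2 ^ m * (|MvPolynomial.eval (fun i => x i) (P a)| *
            (1 + k * rhoMetric Ω x (ξ a)) ^ m) := by
          rw [Finset.sum_mul]
          refine Finset.sum_le_sum fun a ha => ?_
          have hga := hg a
          rw [(Finset.mem_filter.1 ha).2, lt_div_iff₀ hn0] at hga
          have h1 := rhoMetric_triangle Ω x (ξ a) (ξ (s.equivFin.symm j))
          have h2 := rhoMetric_nonneg Ω (ξ a) (ξ (s.equivFin.symm j))
          have hk : (k : ℝ) ≤ n := by exact_mod_cast hkn
          have hk0 : (0 : ℝ) ≤ k := k.cast_nonneg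
          have h3 : 1 + k * rhoMetric Ω x (ξ (s.equivFin.symm j)) ≤
              2 * (1 + k * rhoMetric Ω x (ξ a)) := by
            have := mul_le_mul_of_nonneg_left h1 hk0
            have := mul_le_mul_of_nonneg_right hk h2
            have := mul_nonneg hk0 (hρ (ξ a))
            linarith
          have h4 := hρ (ξ (s.equivFin.symm j))
          have h5 := pow_le_pow_left₀ (by positivity) h3 m
          rw [mul_pow] at h5
          have := mul_le_mul_of_nonneg_left h5 (abs_nonneg (MvPolynomial.eval (fun i => x i) (P a)))
          linarith
      _ ≤ ∑ a, 2 ^ m * (|MvPolynomial.eval (fun i => x i) (P a)| *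
            (1 + k * rhoMetric Ω x (ξ a)) ^ m) := by
          refine Finset.sum_le_sum_of_subset_of_nonneg (Finset.filter_subset _ _) fun a _ _ => ?_
          have := hρ (ξ a)
          positivity
      _ ≤ 2 ^ m * C := by
          rw [← Finset.mul_sum]
          exact mul_le_mul_of_nonneg_left (hloc x hx) (by positivity)

theorem IsCompactC2Domain.isCompact {d : ℕ} {Ω : Set (EuclideanSpace ℝ (Fin (d + 1)))}
    (h : IsCompactC2Domain Ω) : IsCompact Ω := by
  obtain ⟨⟨D, -, -, hb, rfl⟩, -⟩ := h
  exact hb.isCompact_closure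

theorem IsCompactC2Domain.nonempty {d : ℕ} {Ω : Set (EuclideanSpace ℝ (Fin (d + 1)))}
    (h : IsCompactC2Domain Ω) : Ω.Nonempty := by
  obtain ⟨⟨D, -, hc, -, rfl⟩, -⟩ := h
  exact hc.nonempty.closure

theorem mainTheorem4 (d : ℕ) (hd : 1 ≤ d) (l : ℝ) (hl : 1 < l) :
    ∃ c₀ : ℕ, 0 < c₀ ∧
      ∀ Ω : Set (EuclideanSpace ℝ (Fin (d + 1))), IsCompactC2Domain Ω →
        ∃ C₁ : ℝ, 0 < C₁ ∧
          ∀ n : ℕ, 0 < n →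
            ∃ (m : ℕ) (ξ : Fin m → EuclideanSpace ℝ (Fin (d + 1)))
              (P : Fin m → MvPolynomial (Fin (d + 1)) ℝ),
              (∀ j, ξ j ∈ Ω) ∧
              (∀ i j, i ≠ j → 1 / (n : ℝ) ≤ rhoMetric Ω (ξ i) (ξ j)) ∧
              (∀ j, (P j).totalDegree ≤ c₀ * n) ∧
              (∀ x ∈ Ω, ∑ j, MvPolynomial.eval (fun i => x i) (P j) = 1) ∧
              (∀ x ∈ Ω, ∀ j,
                |MvPolynomial.eval (fun i => x i) (P j)| ≤
                  C₁ * (1 + (n : ℝ) * rhoMetric Ω x (ξ j)) ^ (-l)) := by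
  refine ⟨1, one_pos, fun Ω hΩ => ?_⟩
  obtain ⟨x₀, hx₀⟩ := hΩ.nonempty
  obtain ⟨r, hr, hballs⟩ := HasC2Boundary.exists_hasTwoSidedBalls hΩ.isCompact.isClosed hΩ.2
  set m := ⌈l⌉₊ with hm
  obtain ⟨A, C, hA, hC, hpart⟩ := exists_localized_partition hΩ.isCompact hΩ.nonempty hr hballs m
  obtain ⟨D, hD, hρD⟩ := exists_rhoMetric_le hΩ.isCompact
  set K : ℝ := 1 + A + A * D with hK
  have hK0 : 0 < K := by positivity
  refine ⟨K ^ m * (2 ^ m * (C + 1)), by positivity, fun n hn => ?_⟩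
  set k := n / A with hk
  have hkn : k ≤ n := Nat.div_le_self _ _
  have hAk : A * k ≤ 1 * n := by rw [one_mul]; exact Nat.mul_div_le n A
  have hnk : (n : ℝ) ≤ A * k + A := by
    have := (Nat.lt_mul_div_succ n hA).le
    have h2 : (n : ℝ) ≤ ((A * (n / A + 1) : ℕ) : ℝ) := by exact_mod_cast this
    rw [← hk] at h2
    push_cast at h2
    linarith
  have hsep : ∃ (M : ℕ) (ζ : Fin M → EuclideanSpace ℝ (Fin (d + 1)))
      (Q : Fin M → MvPolynomial (Fin (d + 1)) ℝ), (∀ j, ζ j ∈ Ω) ∧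
      (∀ i j, i ≠ j → 1 / (n : ℝ) ≤ rhoMetric Ω (ζ i) (ζ j)) ∧
      (∀ j, (Q j).totalDegree ≤ 1 * n) ∧
      (∀ x ∈ Ω, ∑ j, MvPolynomial.eval (fun i => x i) (Q j) = 1) ∧
      ∀ x ∈ Ω, ∀ j, |MvPolynomial.eval (fun i => x i) (Q j)| *
        (1 + k * rhoMetric Ω x (ζ j)) ^ m ≤ 2 ^ m * (C + 1) := by
    rcases Nat.eq_zero_or_pos k with h0 | h0
    · exact exists_separated_partition (ι := Unit) hn hkn (fun _ => x₀) (fun _ => 1)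
        (fun _ => hx₀) (fun _ => by simp) (fun x _ => by simp) (fun x _ => by simp [h0, hC.le])
    · obtain ⟨ι, _, ξ, P, hξ, hdeg, hsum, hloc⟩ := hpart k h0
      exact exists_separated_partition hn hkn ξ P hξ (fun a => (hdeg a).trans hAk) hsum
        fun x hx => (hloc x hx).trans (by linarith)
  obtain ⟨M, ζ, Q, hζ, hζsep, hQdeg, hQsum, hQ⟩ := hsep
  refine ⟨M, ζ, Q, hζ, hζsep, hQdeg, hQsum, fun x hx j => ?_⟩
  have hρ0 := rhoMetric_nonneg Ω x (ζ j)
  have hρ1 := hρD x hx _ (hζ j)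
  set ρ := rhoMetric Ω x (ζ j)
  have hk0 : (0 : ℝ) ≤ k := k.cast_nonneg
  have hbase : 1 ≤ 1 + n * ρ := le_add_of_nonneg_right (by positivity)
  have h1 : 1 + n * ρ ≤ K * (1 + k * ρ) := by
    have e1 : n * ρ ≤ (A * k + A) * ρ := by gcongr
    have e2 : A * ρ ≤ A * D := by gcongr
    have e3 : 0 ≤ A * D * (k * ρ) := by positivity
    have e4 : 0 ≤ k * ρ := by positivity
    have e5 : (0 : ℝ) ≤ A := A.cast_nonneg
    rw [hK]
    linarith
  have h2 : |MvPolynomial.eval (fun i => x i) (Q j)| * (1 + n * ρ) ^ m ≤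
      K ^ m * (2 ^ m * (C + 1)) := by
    calc _ ≤ |MvPolynomial.eval (fun i => x i) (Q j)| * (K * (1 + k * ρ)) ^ m := by gcongr
      _ = K ^ m * (|MvPolynomial.eval (fun i => x i) (Q j)| * (1 + k * ρ) ^ m) := by
          rw [mul_pow]; ring
      _ ≤ _ := mul_le_mul_of_nonneg_left (hQ x hx j) (by positivity)
  have h3 : (1 + n * ρ) ^ l ≤ (1 + n * ρ) ^ m := by
    rw [← Real.rpow_natCast]
    exact Real.rpow_le_rpow_of_exponent_le hbase (Nat.le_ceil l)
  have hpos : 0 < (1 + n * ρ) ^ l := Real.rpow_pos_of_pos (by linarith) l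
  rw [Real.rpow_neg (by linarith), ← div_eq_mul_inv, le_div_iff₀ hpos]
  exact (mul_le_mul_of_nonneg_left h3 (abs_nonneg _)).trans h2
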